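/- Let $p$ be a prime and let $\mathbb C$ be a complete, non-archimedean, algebraically closed field of characteristic $0$ whose residue field has characteristic $p$. Let $\mathcal O$ be its ring of integers, $\mathcal O^\flat=\varprojlim_{x\mapsto x^p}\mathcal O/p\mathcal O$ its tilt, with maximal ideal $\mathfrak m^\flat$, and $\mathbb A_{\mathrm{inf}}=W(\mathcal O^\flat)$ the ring of $p$-typical Witt vectors, so that $\mathbb A_{\mathrm{inf}}/p\mathbb A_{\mathrm{inf}}=\mathcal O^\flat$. Call an $\mathbb A_{\mathrm{inf}}$-module perfect if it admits a finite length resolution by finite free $\mathbb A_{\mathrm{inf}}$-modules. Then: (ii) If $M$ is a finitely presented $\mathbb A_{\mathrm{inf}}$-module such that $M[\tfrac1p]$ is finite free over $\mathbb A_{\mathrm{inf}}[\tfrac1p]$, then $M$ is perfect. (iii) For finitely presented $\mathbb A_{\mathrm{inf}}$-modules $M$ such that $M[\tfrac1p]$ is finite free over $\mathbb A_{\mathrm{inf}}[\tfrac1p]$, there is an exact sequence of $\mathbb A_{\mathrm{inf}}$-modules, functorial in $M$, \[0\longrightarrow M_{\mathrm{tor}}\longrightarrow M\longrightarrow M_{\mathrm{free}}\longrightarrow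 \overline M\longrightarrow 0,\] such that: $M_{\mathrm{tor}}$ is a perfect $\mathbb A_{\mathrm{inf}}$-module killed by a power of $p$; $M_{\mathrm{free}}$ is a finite free $\mathbb A_{\mathrm{inf}}$-module; and $\overline M$ is a perfect $\mathbb A_{\mathrm{inf}}$-module which, for every $t\in\mathbb A_{\mathrm{inf}}$ whose image in $\mathcal O^\flat$ lies in $\mathfrak m^\flat\setminus\{0\}$, is killed by a power of the ideal $\langle p,t\rangle$. (iv) Finite projective modules over $\mathbb A_{\mathrm{inf}}[\tfrac1p]$ are finite free. -/

import Mathlib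

universe u v w

open CategoryTheory

/-- The ring of integers `𝒪 = {x | ‖x‖ ≤ 1}` of a non-archimedean field `C`. -/
noncomputable abbrev IntegerRing (C : Type u) [NormedField C] [IsUltrametricDist C] :
    ValuationSubring C :=
  (NormedField.valuation (K := C)).valuationSubring

/-- If the residue field of `C` has characteristic `p`, then `p` is not a unit in `𝒪`
(Mathlib's construction of the tilt asks for this). -/
instance IntegerRing.fact_not_isUnit (p : ℕ) (C : Type u) [NormedField C] [IsUltrametricDist C]
    [CharP (IsLocalRing.ResidueField (IntegerRing C)) p] :
    Fact (¬ IsUnit (p : IntegerRing C)) :=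
  ⟨fun h => by
    have h1 := h.map (IsLocalRing.residue (IntegerRing C))
    rw [map_natCast, CharP.cast_eq_zero] at h1
    exact not_isUnit_zero h1⟩

section Ainf

variable (p : ℕ) [Fact p.Prime] (C : Type u) [NormedField C] [IsUltrametricDist C]
  [CharP (IsLocalRing.ResidueField (IntegerRing C)) p]

/-- The tilt `𝒪♭ = lim 𝒪/p` of the ring of integers, the limit being along Frobenius. -/
abbrev TiltRing : Type u := PreTilt (IntegerRing C) p

/-- Fontaine's infinitesimal period ring `𝔸_inf = W(𝒪♭)`. -/
abbrev Ainf : Type u := WittVector p (TiltRing p C)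

/-- The localisation `𝔸_inf[1/p]`. -/
abbrev AinfInvP : Type u := Localization.Away (p : Ainf p C)

end Ainf

/-- An `A`-module `M` is perfect if it has a finite length resolution
`0 → A^(r n) → ⋯ → A^(r 1) → A^(r 0) → M → 0` by finite free `A`-modules. -/
def IsPerfectModule (A : Type u) [CommRing A] (M : Type v) [AddCommGroup M] [Module A M] : Prop :=
  ∃ (n : ℕ) (r : ℕ → ℕ) (d : ∀ i, (Fin (r (i + 1)) → A) →ₗ[A] (Fin (r i) → A))
    (ε : (Fin (r 0) → A) →ₗ[A] M),
    (∀ i, n < i → r i = 0) ∧ Function.Surjective ε ∧ Function.Exact (d 0) ε ∧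
      ∀ i, Function.Exact (d (i + 1)) (d i)

/-- The full subcategory of those `A`-modules `M` which are finitely presented and for which
`M[1/a]` is finite free over `A[1/a]`. -/
def IsFinPresFreeAway (A : Type u) [CommRing A] (a : A) :
    ObjectProperty (ModuleCat.{w} A) := fun M =>
  Module.FinitePresentation A M ∧
    Module.Finite (Localization.Away a) (LocalizedModule (Submonoid.powers a) M) ∧
    Module.Free (Localization.Away a) (LocalizedModule (Submonoid.powers a) M)

/-! Write `A` for `𝔸_inf`. Beyond the last part of (iii), the proof uses only `IsValuativeAt`: `A`
is `p`-torsion free and `p`-adically separated, `p` is a prime in the Jacobson radical, and `A / p =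
𝒪♭` is a valuation ring. No coherence of `A` is assumed. Instead, finite torsion-free modules over
`A / p` are free, and `A / p` is resolved by `p : A → A`. Devissage along powers of `p` then
resolves finitely presented modules killed by `p ^ n`
(`hasFiniteFreeResolution_of_pow_smul_eq_zero`), and finite ones without torsion outside `p`
(`hasFiniteFreeResolution_of_torsionFreeOutside`). Two-out-of-three for finite free resolutions
turns this into finiteness of kernels.

Let `M` be finitely presented with `L = M[1/p]` finite free. The image `N` of `M` lies in a free
lattice `F` with `p ^ m F ⊆ N`. Since `F / N` is resolved, so is `N`; hence `M_tor = ker (M → L)` is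
finitely presented, killed by a power of `p`, and `M` is perfect. `M_free` is the saturation `N'` of
`N`: the elements of `L` that some `s ∉ pA` multiplies into `N`. It lies in `F`, is finite because
`F / N'` has no torsion outside `p`, and is free by `free_of_torsionFree`. Finally `M̄ = N' / N` is
killed by `p ^ m` and by a single `s ∉ pA`; modulo `p`, this `s` divides a power of every `t` in
`𝔪♭`, so a power of `⟨p, t⟩` kills `M̄`.

For (iv), a finite projective module embeds as a summand of `A[1/p] ^ d`. Its intersection with `A ^
d` is finite free by the same arguments, and inverting `p` gives the module back. -/

/-! ### Finite free resolutions: horseshoe, Schanuel, two-out-of-three. -/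

section FreeResolutions

variable {A : Type u} [CommRing A]

/-- The submodule `K ⊆ A ^ r` has a resolution of length `< n` by finite free modules. -/
def Submodule.HasFreeResolution : ℕ → ∀ r : ℕ, Submodule A (Fin r → A) → Prop
  | 0, _, K => K = ⊥
  | n + 1, r, K => ∃ (s : ℕ) (f : (Fin s → A) →ₗ[A] (Fin r → A)),
      LinearMap.range f = K ∧ Submodule.HasFreeResolution n s (LinearMap.ker f)

variable (A) in
/-- The module `M` has a resolution of length `< n` by finite free modules. -/
def HasFreeResolution (n : ℕ) (M : Type v) [AddCommGroup M] [Module A M] : Prop :=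
  match n with
  | 0 => Subsingleton M
  | n + 1 => ∃ (r : ℕ) (ε : (Fin r → A) →ₗ[A] M),
      Function.Surjective ε ∧ Submodule.HasFreeResolution n r (LinearMap.ker ε)

theorem LinearMap.exists_comp_eq_of_range_le {M N P : Type*} [AddCommGroup M] [Module A M]
    [AddCommGroup N] [Module A N] [AddCommGroup P] [Module A P] {f : M →ₗ[A] N}
    (hf : Function.Injective f) (g : P →ₗ[A] N) (h : ∀ x, g x ∈ LinearMap.range f) :
    ∃ k : P →ₗ[A] M, ∀ x, f (k x) = g x := by
  refine ⟨(LinearEquiv.ofInjective f hf).symm.toLinearMap ∘ₗ g.codRestrict _ h, fun x => ?_⟩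
  have := LinearEquiv.apply_symm_apply (LinearEquiv.ofInjective f hf) (g.codRestrict _ h x)
  exact congrArg Subtype.val this

/-- The recursive definition runs through submodules of `A ^ r`, so that the universe of the module
does not vary along it. This equivalence recovers the recursion on kernels regarded as modules. -/
theorem Submodule.hasFreeResolution_iff {n r : ℕ} {K : Submodule A (Fin r → A)} :
    Submodule.HasFreeResolution n r K ↔ _root_.HasFreeResolution A n K := by
  cases n with
  | zero =>
    simp only [Submodule.HasFreeResolution, _root_.HasFreeResolution]
    exact (Submodule.subsingleton_iff_eq_bot).symm
  | succ n =>
    constructor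
    · rintro ⟨s, f, rfl, h⟩
      exact ⟨s, f.rangeRestrict, f.surjective_rangeRestrict, by rwa [LinearMap.ker_rangeRestrict]⟩
    · rintro ⟨s, f, hf, h⟩
      refine ⟨s, K.subtype ∘ₗ f, ?_, ?_⟩
      · rw [LinearMap.range_comp, LinearMap.range_eq_top.2 hf, Submodule.map_top,
          Submodule.range_subtype]
      · rwa [LinearMap.ker_comp, Submodule.ker_subtype, Submodule.comap_bot]

namespace HasFreeResolution

theorem succ_iff {n : ℕ} {M : Type v} [AddCommGroup M] [Module A M] :
    HasFreeResolution A (n + 1) M ↔ ∃ (r : ℕ) (ε : (Fin r → A) →ₗ[A] M),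
      Function.Surjective ε ∧ HasFreeResolution A n (LinearMap.ker ε) := by
  simp only [← Submodule.hasFreeResolution_iff]
  rfl

theorem of_equiv {n : ℕ} {M : Type v} {N : Type w} [AddCommGroup M] [Module A M]
    [AddCommGroup N] [Module A N] (e : M ≃ₗ[A] N) (h : HasFreeResolution A n M) :
    HasFreeResolution A n N := by
  cases n with
  | zero =>
    have : Subsingleton M := h
    exact e.symm.toEquiv.subsingleton
  | succ n =>
    obtain ⟨r, ε, hε, h⟩ := h
    exact ⟨r, e.toLinearMap ∘ₗ ε, e.surjective.comp hε, by rwa [LinearEquiv.ker_comp]⟩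

theorem of_free_surjective {n : ℕ} {M : Type v} {F : Type w} [AddCommGroup M] [Module A M]
    [AddCommGroup F] [Module A F] [Module.Free A F] [Module.Finite A F] (f : F →ₗ[A] M)
    (hf : Function.Surjective f) (h : HasFreeResolution A n (LinearMap.ker f)) :
    HasFreeResolution A (n + 1) M := by
  let e := ((Module.Free.chooseBasis A F).reindex (Fintype.equivFin _)).equivFun
  refine succ_iff.2 ⟨_, f ∘ₗ e.symm.toLinearMap, hf.comp e.symm.surjective, ?_⟩
  refine of_equiv (e.submoduleMap _ ≪≫ₗ LinearEquiv.ofEq _ _ ?_) h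
  ext x
  simp [Submodule.mem_map_equiv]

/-- Kernels of maps out of `A ^ r` live in `Type u`, so the induction is run there; for a general
module one step reduces to this case. -/
theorem succ_same {n : ℕ} : ∀ {M : Type u} [AddCommGroup M] [Module A M],
    HasFreeResolution A n M → HasFreeResolution A (n + 1) M := by
  induction n with
  | zero =>
    intro M _ _ h
    have : Subsingleton M := h
    refine of_free_surjective (0 : (Fin 0 → A) →ₗ[A] M)
      (fun x => ⟨0, Subsingleton.elim _ _⟩) (inferInstanceAs (Subsingleton _))
  | succ n ih =>
    intro M _ _ h
    obtain ⟨r, ε, hε, h⟩ := succ_iff.1 h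
    exact succ_iff.2 ⟨r, ε, hε, ih h⟩

theorem succ {n : ℕ} {M : Type v} [AddCommGroup M] [Module A M]
    (h : HasFreeResolution A n M) : HasFreeResolution A (n + 1) M := by
  cases n with
  | zero =>
    have : Subsingleton M := h
    refine of_free_surjective (0 : (Fin 0 → A) →ₗ[A] M)
      (fun x => ⟨0, Subsingleton.elim _ _⟩) (inferInstanceAs (Subsingleton _))
  | succ n =>
    obtain ⟨r, ε, hε, h⟩ := succ_iff.1 h
    exact succ_iff.2 ⟨r, ε, hε, h.succ_same⟩

theorem mono {m n : ℕ} (hmn : m ≤ n) {M : Type v} [AddCommGroup M] [Module A M]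
    (h : HasFreeResolution A m M) : HasFreeResolution A n M := by
  induction hmn with
  | refl => exact h
  | step _ ih => exact ih.succ

/-- The horseshoe lemma, as an induction step. -/
theorem extension_succ {n : ℕ}
    (ih : ∀ {K K₁ K₂ : Type u} [AddCommGroup K] [Module A K] [AddCommGroup K₁] [Module A K₁]
      [AddCommGroup K₂] [Module A K₂] (f : K₁ →ₗ[A] K) (g : K →ₗ[A] K₂),
      Function.Injective f → Function.Exact f g → Function.Surjective g →
      HasFreeResolution A n K₁ → HasFreeResolution A n K₂ → HasFreeResolution A n K)
    {M M₁ M₂ : Type*} [AddCommGroup M] [Module A M] [AddCommGroup M₁] [Module A M₁]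
    [AddCommGroup M₂] [Module A M₂] (f : M₁ →ₗ[A] M) (g : M →ₗ[A] M₂)
    (hf : Function.Injective f) (hfg : Function.Exact f g) (hg : Function.Surjective g)
    (h₁ : HasFreeResolution A (n + 1) M₁) (h₂ : HasFreeResolution A (n + 1) M₂) :
    HasFreeResolution A (n + 1) M := by
  obtain ⟨r₁, ε₁, hε₁, h₁⟩ := succ_iff.1 h₁
  obtain ⟨r₂, ε₂, hε₂, h₂⟩ := succ_iff.1 h₂
  obtain ⟨l, hl⟩ := Module.projective_lifting_property g ε₂ hg
  have hl' : ∀ y, g (l y) = ε₂ y := fun y => LinearMap.congr_fun hl y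
  have hgf : ∀ x, g (f x) = 0 := hfg.apply_apply_eq_zero
  let ε : ((Fin r₁ → A) × (Fin r₂ → A)) →ₗ[A] M := (f ∘ₗ ε₁).coprod l
  have hε : ∀ z, ε z = f (ε₁ z.1) + l z.2 := fun z => rfl
  have hsurj : Function.Surjective ε := by
    intro m
    obtain ⟨y, hy⟩ := hε₂ (g m)
    obtain ⟨m₁, hm₁⟩ := (hfg (m - l y)).1 (by rw [map_sub, hl', hy, sub_self])
    obtain ⟨x, rfl⟩ := hε₁ m₁
    exact ⟨(x, y), by rw [hε, hm₁]; abel⟩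
  refine of_free_surjective ε hsurj ?_
  let i : LinearMap.ker ε₁ →ₗ[A] LinearMap.ker ε :=
    ((LinearMap.inl A _ _).comp (LinearMap.ker ε₁).subtype).codRestrict _ (fun x => by
      have := x.2
      rw [LinearMap.mem_ker] at this ⊢
      simp [hε, this])
  let q : LinearMap.ker ε →ₗ[A] LinearMap.ker ε₂ :=
    ((LinearMap.snd A _ _).comp (LinearMap.ker ε).subtype).codRestrict _ (fun x => by
      have := x.2
      rw [LinearMap.mem_ker, hε] at this
      have := congrArg g this
      rw [map_add, hgf, hl', zero_add, map_zero] at this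
      exact this)
  refine ih i q ?_ ?_ ?_ h₁ h₂
  · intro x y hxy
    exact Subtype.ext (congrArg (fun z => z.1.1) hxy)
  · rintro ⟨⟨x, y⟩, hz⟩
    constructor
    · intro h
      have hy : y = 0 := congrArg Subtype.val h
      subst hy
      refine ⟨⟨x, ?_⟩, Subtype.ext rfl⟩
      rw [LinearMap.mem_ker, hε] at hz
      simp only [map_zero, add_zero] at hz
      exact hf (by rw [hz, map_zero])
    · rintro ⟨x', h⟩
      exact Subtype.ext (congrArg (fun z => z.1.2) h).symm
  · rintro ⟨y, hy⟩
    rw [LinearMap.mem_ker] at hy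
    obtain ⟨m₁, hm₁⟩ := (hfg (l y)).1 (by rw [hl', hy])
    obtain ⟨x, hx⟩ := hε₁ (-m₁)
    refine ⟨⟨(x, y), ?_⟩, rfl⟩
    rw [LinearMap.mem_ker, hε, hx, map_neg, hm₁, neg_add_cancel]

theorem extension_same (n : ℕ) :
    ∀ {M M₁ M₂ : Type u} [AddCommGroup M] [Module A M] [AddCommGroup M₁] [Module A M₁]
    [AddCommGroup M₂] [Module A M₂] (f : M₁ →ₗ[A] M) (g : M →ₗ[A] M₂),
    Function.Injective f → Function.Exact f g → Function.Surjective g →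
    HasFreeResolution A n M₁ → HasFreeResolution A n M₂ → HasFreeResolution A n M := by
  induction n with
  | zero =>
    intro M M₁ M₂ _ _ _ _ _ _ f g hf hfg hg h₁ h₂
    have : Subsingleton M₁ := h₁
    have : Subsingleton M₂ := h₂
    refine ⟨fun x y => ?_⟩
    obtain ⟨z, hz⟩ := (hfg (x - y)).1 (Subsingleton.elim _ _)
    rw [Subsingleton.elim z 0, map_zero] at hz
    exact (sub_eq_zero.1 hz.symm)
  | succ n ih => exact fun f g hf hfg hg h₁ h₂ => extension_succ ih f g hf hfg hg h₁ h₂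

end HasFreeResolution

variable (A) in
/-- The module `M` has some finite resolution by finite free modules. -/
def HasFiniteFreeResolution (M : Type v) [AddCommGroup M] [Module A M] : Prop :=
  ∃ n, HasFreeResolution A n M

namespace HasFiniteFreeResolution

variable {M : Type*} {M₁ : Type*} {M₂ : Type*} [AddCommGroup M] [Module A M]
  [AddCommGroup M₁] [Module A M₁] [AddCommGroup M₂] [Module A M₂]

theorem of_equiv (e : M ≃ₗ[A] M₁) (h : HasFiniteFreeResolution A M) :
    HasFiniteFreeResolution A M₁ :=
  h.imp fun _ h => h.of_equiv e

theorem of_free_surjective [Module.Free A M] [Module.Finite A M] (f : M →ₗ[A] M₁)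
    (hf : Function.Surjective f) (h : HasFiniteFreeResolution A (LinearMap.ker f)) :
    HasFiniteFreeResolution A M₁ :=
  h.elim fun n h => ⟨n + 1, h.of_free_surjective f hf⟩

theorem of_subsingleton [Subsingleton M] : HasFiniteFreeResolution A M :=
  ⟨0, ‹_›⟩

variable (A M) in
theorem of_free [Module.Free A M] [Module.Finite A M] : HasFiniteFreeResolution A M :=
  of_free_surjective LinearMap.id Function.surjective_id
    (by rw [LinearMap.ker_id]; exact of_subsingleton)

theorem extension (f : M₁ →ₗ[A] M) (g : M →ₗ[A] M₂) (hf : Function.Injective f)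
    (hfg : Function.Exact f g) (hg : Function.Surjective g)
    (h₁ : HasFiniteFreeResolution A M₁) (h₂ : HasFiniteFreeResolution A M₂) :
    HasFiniteFreeResolution A M := by
  obtain ⟨m, h₁⟩ := h₁
  obtain ⟨n, h₂⟩ := h₂
  -- The extra `1` pays for one horseshoe step, which replaces the three modules by kernels in `Type
  -- u`, where `extension_same` applies.
  exact ⟨max m n + 1, HasFreeResolution.extension_succ (HasFreeResolution.extension_same _)
    f g hf hfg hg (h₁.mono (by omega)) (h₂.mono (by omega))⟩

theorem exists_surjective (h : HasFiniteFreeResolution A M) :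
    ∃ (r : ℕ) (ε : (Fin r → A) →ₗ[A] M),
      Function.Surjective ε ∧ HasFiniteFreeResolution A (LinearMap.ker ε) := by
  obtain ⟨n, h⟩ := h
  obtain ⟨r, ε, hε, h⟩ := HasFreeResolution.succ_iff.1 h.succ
  exact ⟨r, ε, hε, n, h⟩

/-- Pulling back a presentation of `M` along an exact sequence gives an exact sequence of
kernels. -/
theorem exists_exact_ker {F : Type*} [AddCommGroup F] [Module A F] (f : M₁ →ₗ[A] M)
    (g : M →ₗ[A] M₂) (hf : Function.Injective f) (hfg : Function.Exact f g) (ε : F →ₗ[A] M)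
    (hε : Function.Surjective ε) :
    ∃ (i : LinearMap.ker ε →ₗ[A] LinearMap.ker (g ∘ₗ ε)) (q : LinearMap.ker (g ∘ₗ ε) →ₗ[A] M₁),
      Function.Injective i ∧ Function.Exact i q ∧ Function.Surjective q := by
  obtain ⟨q, hq⟩ := LinearMap.exists_comp_eq_of_range_le hf
    (ε ∘ₗ (LinearMap.ker (g ∘ₗ ε)).subtype) (fun x => (hfg _).1 x.2)
  have hle : LinearMap.ker ε ≤ LinearMap.ker (g ∘ₗ ε) := fun x hx => by
    rw [LinearMap.mem_ker] at hx
    simp [hx]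
  refine ⟨Submodule.inclusion hle, q, Submodule.inclusion_injective hle, fun x => ?_, fun y => ?_⟩
  · rw [← hf.eq_iff, hq, map_zero]
    constructor
    · exact fun h => ⟨⟨x.1, h⟩, rfl⟩
    · rintro ⟨y, rfl⟩
      exact y.2
  · obtain ⟨x, hx⟩ := hε (f y)
    refine ⟨⟨x, ?_⟩, hf ?_⟩
    · simp [hx, hfg.apply_apply_eq_zero]
    · rw [hq]; exact hx

/-- For a free cover `ε` of `M`, the kernel of `g ∘ₗ ε` is an extension of `M₁` by `ker ε`, so the
horseshoe lemma resolves it. -/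
theorem of_exact_right (f : M₁ →ₗ[A] M) (g : M →ₗ[A] M₂) (hf : Function.Injective f)
    (hfg : Function.Exact f g) (hg : Function.Surjective g)
    (h₁ : HasFiniteFreeResolution A M₁) (h : HasFiniteFreeResolution A M) :
    HasFiniteFreeResolution A M₂ := by
  obtain ⟨r, ε, hε, h⟩ := h.exists_surjective
  obtain ⟨i, q, hi, hiq, hq⟩ := exists_exact_ker f g hf hfg ε hε
  exact of_free_surjective (g ∘ₗ ε) (hg.comp hε) (extension i q hi hiq hq h h₁)

theorem of_prod_left (h : HasFiniteFreeResolution A (M × M₁)) [Module.Free A M₁]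
    [Module.Finite A M₁] : HasFiniteFreeResolution A M :=
  of_exact_right (LinearMap.inr A M M₁) (LinearMap.fst A M M₁) LinearMap.inr_injective
    Function.Exact.inr_fst LinearMap.fst_surjective (of_free A M₁) h

/-- The kernel of a surjection from a projective module onto a module does not depend on the
surjection, up to projective summands. -/
theorem ker_of_free_surjective [Module.Free A M] [Module.Finite A M] (f : M →ₗ[A] M₁)
    (hf : Function.Surjective f) (h : HasFiniteFreeResolution A M₁) :
    HasFiniteFreeResolution A (LinearMap.ker f) := by
  obtain ⟨r, ε, hε, h⟩ := h.exists_surjective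
  obtain ⟨a, ha⟩ := Module.projective_lifting_property f ε hf
  obtain ⟨b, hb⟩ := Module.projective_lifting_property ε f hε
  have ha' : ∀ x, f (a x) = ε x := LinearMap.congr_fun ha
  have hb' : ∀ x, ε (b x) = f x := LinearMap.congr_fun hb
  -- Schanuel's argument: up to sign, `ker g` is the fibre product of the two covers. It is an
  -- extension of `M` by `ker ε`, and the lift `a` identifies it with `ker f × A ^ r`; the free
  -- factor is then cancelled.
  let g : ((Fin r → A) × M) →ₗ[A] M₁ := ε.coprod f
  have hg : ∀ z, g z = ε z.1 + f z.2 := fun _ => rfl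
  have h₁ : HasFiniteFreeResolution A (LinearMap.ker g) := by
    refine extension (M₁ := LinearMap.ker ε) (M₂ := M)
      (((LinearMap.inl A _ _).comp (LinearMap.ker ε).subtype).codRestrict _ ?_)
      ((LinearMap.snd A _ _).comp (LinearMap.ker g).subtype) ?_ ?_ ?_ h (of_free A M)
    · rintro ⟨x, hx⟩
      simpa [hg] using hx
    · exact fun x y hxy => Subtype.ext (congrArg (fun z => z.1.1) hxy)
    · rintro ⟨⟨x, y⟩, hz⟩
      constructor
      · rintro (rfl : y = 0)
        exact ⟨⟨x, by simpa [hg] using hz⟩, rfl⟩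
      · rintro ⟨x', h⟩
        exact (congrArg (fun z => z.1.2) h).symm
    · exact fun y => ⟨⟨(-b y, y), by simp [hg, hb']⟩, rfl⟩
  let q : LinearMap.ker g →ₗ[A] LinearMap.ker f :=
    (((LinearMap.snd A _ _) + a.comp (LinearMap.fst A _ _)).comp
      (LinearMap.ker g).subtype).codRestrict (LinearMap.ker f) (by
        rintro ⟨⟨x, y⟩, hz⟩
        rw [LinearMap.mem_ker, hg] at hz
        simpa [ha', add_comm] using hz)
  let φ := q.prod ((LinearMap.fst A _ _).comp (LinearMap.ker g).subtype)
  have hφ : ∀ z, φ z = (q z, z.1.1) := fun _ => rfl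
  have hq : ∀ z, (q z : M) = z.1.2 + a z.1.1 := fun _ => rfl
  refine of_prod_left (M₁ := Fin r → A) (of_equiv (LinearEquiv.ofBijective φ ⟨?_, ?_⟩) h₁)
  · intro z w h
    rw [hφ, hφ, Prod.ext_iff] at h
    have h₁ := congrArg Subtype.val h.1
    have h₂ : z.1.1 = w.1.1 := h.2
    rw [hq, hq, h₂] at h₁
    exact Subtype.ext (Prod.ext h₂ (add_right_cancel h₁))
  · rintro ⟨⟨y, hy⟩, x⟩
    rw [LinearMap.mem_ker] at hy
    refine ⟨⟨(x, y - a x), by simp [hg, ha', hy]⟩, ?_⟩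
    exact Prod.ext (Subtype.ext (sub_add_cancel _ _)) rfl

/-- In the sequence `ker ε → ker (g ∘ₗ ε) → M₁`, the middle term is resolved by Schanuel's lemma. -/
theorem of_exact_left (f : M₁ →ₗ[A] M) (g : M →ₗ[A] M₂) (hf : Function.Injective f)
    (hfg : Function.Exact f g) (hg : Function.Surjective g)
    (h : HasFiniteFreeResolution A M) (h₂ : HasFiniteFreeResolution A M₂) :
    HasFiniteFreeResolution A M₁ := by
  obtain ⟨r, ε, hε, h⟩ := h.exists_surjective
  obtain ⟨i, q, hi, hiq, hq⟩ := exists_exact_ker f g hf hfg ε hε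
  exact of_exact_right i q hi hiq hq h (ker_of_free_surjective (g ∘ₗ ε) (hg.comp hε) h₂)

theorem finite (h : HasFiniteFreeResolution A M) : Module.Finite A M := by
  obtain ⟨r, ε, hε, -⟩ := h.exists_surjective
  exact Module.Finite.of_surjective ε hε

theorem finitePresentation (h : HasFiniteFreeResolution A M) : Module.FinitePresentation A M := by
  obtain ⟨r, ε, hε, h⟩ := h.exists_surjective
  exact Module.finitePresentation_of_surjective ε hε (Module.Finite.iff_fg.1 h.finite)

/-- The kernel of a surjection from a finitely presented module onto one with a finite free
resolution is finitely presented. -/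
theorem finitePresentation_of_exact [Module.FinitePresentation A M] (f : M₁ →ₗ[A] M)
    (g : M →ₗ[A] M₂) (hf : Function.Injective f) (hfg : Function.Exact f g)
    (hg : Function.Surjective g) (h₂ : HasFiniteFreeResolution A M₂) :
    Module.FinitePresentation A M₁ := by
  obtain ⟨r, ε, hε⟩ := Module.Finite.exists_fin' A M
  obtain ⟨i, q, hi, hiq, hq⟩ := exists_exact_ker f g hf hfg ε hε
  -- The middle kernel is finitely presented, and `M₁` is its quotient by the finitely generated
  -- `ker ε`.
  have := (ker_of_free_surjective (g ∘ₗ ε) (hg.comp hε) h₂).finitePresentation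
  refine Module.finitePresentation_of_surjective q hq ?_
  rw [hiq.linearMap_ker_eq]
  have := Module.Finite.iff_fg.2 (Module.FinitePresentation.fg_ker ε hε)
  exact Module.Finite.iff_fg.1 inferInstance

end HasFiniteFreeResolution

theorem IsPerfectModule.of_surjective {M : Type v} [AddCommGroup M] [Module A M] {s : ℕ}
    (f : (Fin s → A) →ₗ[A] M) (hf : Function.Surjective f)
    (h : IsPerfectModule A (LinearMap.ker f)) : IsPerfectModule A M := by
  obtain ⟨n, r, d, ε, hr, hε, h₀, h⟩ := h
  let r' : ℕ → ℕ := fun i => i.casesOn s r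
  let d' : ∀ i, (Fin (r' (i + 1)) → A) →ₗ[A] (Fin (r' i) → A) := fun i =>
    match i with
    | 0 => (LinearMap.ker f).subtype ∘ₗ ε
    | i + 1 => d i
  refine ⟨n + 1, r', d', f, ?_, hf, ?_, ?_⟩
  · rintro (_ | i) hi
    · omega
    · exact hr i (by omega)
  · intro x
    constructor
    · intro hx
      obtain ⟨y, hy⟩ := hε ⟨x, hx⟩
      exact ⟨y, congrArg Subtype.val hy⟩
    · rintro ⟨y, rfl⟩
      exact (ε y).2
  · rintro (_ | i)
    · intro x
      rw [← h₀ x]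
      exact Submodule.coe_eq_zero
    · exact h i

theorem IsPerfectModule.of_subsingleton {M : Type v} [AddCommGroup M] [Module A M]
    [Subsingleton M] : IsPerfectModule A M := by
  refine ⟨0, fun _ => 0, fun _ => 0, 0, fun _ _ => rfl, fun x => ⟨0, Subsingleton.elim _ _⟩,
    fun x => ?_, fun i x => ?_⟩
  · exact ⟨fun _ => ⟨0, Subsingleton.elim _ _⟩, fun _ => rfl⟩
  · exact ⟨fun _ => ⟨0, Subsingleton.elim _ _⟩, fun _ => rfl⟩

theorem HasFreeResolution.isPerfectModule_same (n : ℕ) :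
    ∀ {M : Type u} [AddCommGroup M] [Module A M], HasFreeResolution A n M →
      IsPerfectModule A M := by
  induction n with
  | zero =>
    intro M _ _ h
    have : Subsingleton M := h
    exact IsPerfectModule.of_subsingleton
  | succ n ih =>
    intro M _ _ h
    obtain ⟨r, ε, hε, h⟩ := HasFreeResolution.succ_iff.1 h
    exact IsPerfectModule.of_surjective ε hε (ih h)

theorem HasFiniteFreeResolution.isPerfectModule {M : Type v} [AddCommGroup M] [Module A M]
    (h : HasFiniteFreeResolution A M) : IsPerfectModule A M := by
  obtain ⟨r, ε, hε, n, h⟩ := h.exists_surjective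
  exact IsPerfectModule.of_surjective ε hε (h.isPerfectModule_same)

end FreeResolutions

/-! ### Modules over a ring whose reduction modulo `p` is a valuation ring. -/

section PadicValued

variable {A : Type u} [CommRing A]

/-- The ring `A` is `p`-torsion free and `p`-adically separated, `p` lies in its Jacobson radical,
and `A / p` is a valuation ring. -/
structure IsValuativeAt (p : A) : Prop where
  prime : Prime p
  mul_eq_zero : ∀ x, p * x = 0 → x = 0
  mem_jacobson : p ∈ Ideal.jacobson (⊥ : Ideal A)
  separated : ∀ x, (∀ n, p ^ n ∣ x) → x = 0
  total : ∀ x y, ∃ c, p ∣ c * x - y ∨ p ∣ c * y - x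

/-- The module `M` has no torsion with respect to elements not divisible by `p`. -/
def IsTorsionFreeOutside (p : A) (M : Type*) [AddCommGroup M] [Module A M] : Prop :=
  ∀ (s : A) (x : M), ¬ p ∣ s → s • x = 0 → x = 0

namespace IsValuativeAt

variable {p : A}

theorem isDomain_quotient (hp : IsValuativeAt p) : IsDomain (A ⧸ Ideal.span {p}) :=
  (Ideal.Quotient.isDomain_iff_prime _).2
    ((Ideal.span_singleton_prime hp.prime.ne_zero).2 hp.prime)

theorem valuationRing_quotient (hp : IsValuativeAt p) :
    haveI := hp.isDomain_quotient
    ValuationRing (A ⧸ Ideal.span {p}) := by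
  have := hp.isDomain_quotient
  rw [ValuationRing.iff_dvd_total]
  refine ⟨fun x y => ?_⟩
  obtain ⟨x, rfl⟩ := Ideal.Quotient.mk_surjective x
  obtain ⟨y, rfl⟩ := Ideal.Quotient.mk_surjective y
  obtain ⟨c, h | h⟩ := hp.total x y
  · refine Or.inl ⟨Ideal.Quotient.mk _ c, ?_⟩
    rw [← map_mul, eq_comm, Ideal.Quotient.eq, Ideal.mem_span_singleton, mul_comm]
    exact h
  · refine Or.inr ⟨Ideal.Quotient.mk _ c, ?_⟩
    rw [← map_mul, eq_comm, Ideal.Quotient.eq, Ideal.mem_span_singleton, mul_comm]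
    exact h

theorem dvd_of_mul (hp : IsValuativeAt p) {s x : A} (hs : ¬ p ∣ s) (h : p ∣ s * x) : p ∣ x :=
  (hp.prime.dvd_or_dvd h).resolve_left hs

variable {Q : Type*} [AddCommGroup Q] [Module A Q]

/-- A finite module over `A / p` without torsion is free over `A / p`. -/
theorem exists_surjective_of_smul_eq_zero (hp : IsValuativeAt p) [Module.Finite A Q]
    (hQ : ∀ x : Q, p • x = 0) (htf : IsTorsionFreeOutside p Q) :
    ∃ (d : ℕ) (ε : (Fin d → A) →ₗ[A] Q), Function.Surjective ε ∧
      ∀ x, ε x = 0 ↔ ∀ i, p ∣ x i := by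
  have := hp.isDomain_quotient
  have := hp.valuationRing_quotient
  have hT : Module.IsTorsionBySet A Q (Ideal.span {p} : Ideal A) :=
    (Module.isTorsionBySet_span_singleton_iff p).2 fun x => hQ x
  let _ := hT.module
  have : IsScalarTower A (A ⧸ Ideal.span {p}) Q := hT.isScalarTower
  have hsmul : ∀ (a : A) (x : Q), Ideal.Quotient.mk (Ideal.span {p}) a • x = a • x :=
    fun a x => rfl
  have : Module.Finite (A ⧸ Ideal.span {p}) Q := Module.Finite.of_restrictScalars_finite A _ _
  -- Over a valuation ring torsion-free modules are flat, and finite flat modules over a local ring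
  -- are free.
  have : Module.Flat (A ⧸ Ideal.span {p}) Q := by
    rw [Module.Flat.flat_iff_torsion_eq_bot_of_isBezout, eq_bot_iff]
    rintro x ⟨⟨s, hs⟩, hsx⟩
    obtain ⟨s, rfl⟩ := Ideal.Quotient.mk_surjective s
    refine htf s x (fun h => ?_) hsx
    exact nonZeroDivisors.ne_zero hs
      (Ideal.Quotient.eq_zero_iff_mem.2 (Ideal.mem_span_singleton.2 h))
  have : Module.Free (A ⧸ Ideal.span {p}) Q := Module.free_of_flat_of_isLocalRing
  let b := Module.finBasis (A ⧸ Ideal.span {p}) Q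
  have hε : ∀ x : Fin _ → A, Fintype.linearCombination A b x =
      Fintype.linearCombination (A ⧸ Ideal.span {p}) b
        (fun i => Ideal.Quotient.mk (Ideal.span {p}) (x i)) := fun x => by
    simp only [Fintype.linearCombination_apply, hsmul]
  refine ⟨_, Fintype.linearCombination A b, fun y => ?_, fun x => ?_⟩
  · choose c hc using fun i => Ideal.Quotient.mk_surjective (b.repr y i)
    refine ⟨c, ?_⟩
    rw [hε]
    simp only [hc]
    rw [Fintype.linearCombination_apply, b.sum_repr]
  · rw [hε]
    constructor
    · intro h i
      have := Fintype.linearIndependent_iff.1 b.linearIndependent _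
        ((Fintype.linearCombination_apply _ _ _).symm.trans h) i
      exact Ideal.mem_span_singleton.1 (Ideal.Quotient.eq_zero_iff_mem.1 this)
    · intro h
      rw [Fintype.linearCombination_apply]
      refine Finset.sum_eq_zero fun i _ => ?_
      rw [Ideal.Quotient.eq_zero_iff_mem.2 (Ideal.mem_span_singleton.2 (h i)), zero_smul]

theorem exists_eq_smul {ι : Type*} {x : ι → A} (h : ∀ i, p ∣ x i) : ∃ y : ι → A, x = p • y := by
  choose y hy using h
  exact ⟨y, funext hy⟩

theorem smul_pi_injective (hp : IsValuativeAt p) {ι : Type*} {x : ι → A} (h : p • x = 0) :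
    x = 0 :=
  funext fun i => hp.mul_eq_zero _ (congrFun h i)

/-- A finite module without `p`-torsion is free if its reduction has no torsion. -/
theorem free_of_torsionFree (hp : IsValuativeAt p) [Module.Finite A Q]
    (hQ : ∀ x : Q, p • x = 0 → x = 0)
    (htf : ∀ (s : A) (x y : Q), ¬ p ∣ s → s • x = p • y → ∃ z, x = p • z) :
    Module.Free A Q := by
  let π := (LinearMap.range (LinearMap.lsmul A Q p)).mkQ
  have hπ : ∀ x, π x = 0 ↔ ∃ y, p • y = x := fun x => by
    rw [← LinearMap.mem_ker, Submodule.ker_mkQ]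
    rfl
  obtain ⟨d, ε, hε, hker⟩ := hp.exists_surjective_of_smul_eq_zero
    (Q := Q ⧸ LinearMap.range (LinearMap.lsmul A Q p))
    (fun x => by
      obtain ⟨x, rfl⟩ := Submodule.mkQ_surjective _ x
      rw [← map_smul]
      exact (hπ _).2 ⟨x, rfl⟩)
    (fun s x hs h => by
      obtain ⟨x, rfl⟩ := Submodule.mkQ_surjective _ x
      rw [← map_smul] at h
      obtain ⟨y, hy⟩ := (hπ _).1 h
      obtain ⟨z, hz⟩ := htf s x y hs hy.symm
      exact (hπ _).2 ⟨z, hz.symm⟩)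
  obtain ⟨g, hg⟩ := Module.projective_lifting_property π ε (Submodule.mkQ_surjective _)
  have hg' : ∀ x, π (g x) = ε x := LinearMap.congr_fun hg
  have hsurj : Function.Surjective g := by
    rw [← LinearMap.range_eq_top, ← top_le_iff]
    refine Submodule.le_of_le_smul_of_le_jacobson_bot (I := Ideal.span {p})
      Module.Finite.fg_top ((Ideal.span_singleton_le_iff_mem _).2 hp.mem_jacobson) ?_
    rintro x -
    obtain ⟨c, hc⟩ := hε (π x)
    obtain ⟨y, hy⟩ := (hπ (x - g c)).1 (by rw [map_sub, hg', hc, sub_self])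
    rw [← add_sub_cancel (g c) x, ← hy]
    exact Submodule.add_mem_sup ⟨c, rfl⟩
      (Submodule.smul_mem_smul (Ideal.mem_span_singleton_self p) trivial)
  -- The kernel of `g` is `p`-divisible: it lies in `p A ^ d`, and `Q` has no `p`-torsion. It thus
  -- lies in every `p ^ n A ^ d`, and separatedness makes it zero.
  have hdiv : ∀ x, g x = 0 → ∃ y, x = p • y ∧ g y = 0 := by
    intro x hx
    obtain ⟨y, rfl⟩ := exists_eq_smul ((hker x).1 (by rw [← hg', hx, map_zero]))
    exact ⟨y, rfl, hQ _ (by rw [← map_smul, hx])⟩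
  have hpow : ∀ n x, g x = 0 → ∃ y, x = p ^ n • y ∧ g y = 0 := by
    intro n
    induction n with
    | zero => exact fun x hx => ⟨x, by simp, hx⟩
    | succ n ih =>
      intro x hx
      obtain ⟨y, rfl, hy⟩ := ih x hx
      obtain ⟨z, rfl, hz⟩ := hdiv y hy
      exact ⟨z, by rw [smul_smul, pow_succ], hz⟩
  have hinj : Function.Injective g := by
    rw [injective_iff_map_eq_zero]
    refine fun x hx => funext fun i => hp.separated _ fun n => ?_
    obtain ⟨y, rfl, -⟩ := hpow n x hx
    exact ⟨y i, rfl⟩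
  exact Module.Free.of_equiv (LinearEquiv.ofBijective g ⟨hinj, hsurj⟩)

/-- Here `Q ≅ (A / p) ^ d`, resolved by multiplication by `p` on `A ^ d`. -/
theorem hasFiniteFreeResolution_of_smul_eq_zero (hp : IsValuativeAt p) [Module.Finite A Q]
    (hQ : ∀ x : Q, p • x = 0) (htf : IsTorsionFreeOutside p Q) : HasFiniteFreeResolution A Q := by
  obtain ⟨d, ε, hε, hker⟩ := hp.exists_surjective_of_smul_eq_zero hQ htf
  refine .of_free_surjective ε hε (.of_equiv (LinearEquiv.ofBijective
    ((LinearMap.lsmul A (Fin d → A) p).codRestrict (LinearMap.ker ε) fun x =>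
      (hker _).2 fun i => ⟨x i, rfl⟩) ⟨?_, ?_⟩) (.of_free A (Fin d → A)))
  · rw [injective_iff_map_eq_zero]
    exact fun x hx => hp.smul_pi_injective (congrArg Subtype.val hx)
  · rintro ⟨x, hx⟩
    obtain ⟨y, rfl⟩ := exists_eq_smul ((hker x).1 hx)
    exact ⟨y, rfl⟩

/-- Write `Q = A ^ r / K` with `K` finite. Then `K ⊇ p A ^ r ≅ A ^ r`, and `K / p A ^ r` is a finite
submodule of `(A / p) ^ r`, hence torsion free and already resolved. -/
theorem hasFiniteFreeResolution_of_finitePresentation_of_smul_eq_zero (hp : IsValuativeAt p)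
    [Module.FinitePresentation A Q] (hQ : ∀ x : Q, p • x = 0) : HasFiniteFreeResolution A Q := by
  obtain ⟨r, ε, hε⟩ := Module.Finite.exists_fin' A Q
  have : Module.Finite A (LinearMap.ker ε) :=
    Module.Finite.iff_fg.2 (Module.FinitePresentation.fg_ker ε hε)
  let f := (LinearMap.lsmul A (Fin r → A) p).codRestrict (LinearMap.ker ε) fun x => by
    rw [LinearMap.mem_ker, LinearMap.lsmul_apply, map_smul, hQ]
  let π := (LinearMap.range f).mkQ
  have hf : ∀ x, (f x : Fin r → A) = p • x := fun x => rfl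
  have hπ : ∀ x, π x = 0 ↔ ∃ y, f y = x := fun x => by
    rw [← LinearMap.mem_ker, Submodule.ker_mkQ]
    rfl
  refine .of_free_surjective ε hε (.extension f π ?_ hπ (Submodule.mkQ_surjective _)
    (.of_free A _) (hp.hasFiniteFreeResolution_of_smul_eq_zero ?_ ?_))
  · rw [injective_iff_map_eq_zero]
    exact fun x hx => hp.smul_pi_injective (congrArg Subtype.val hx)
  · intro x
    obtain ⟨x, rfl⟩ := Submodule.mkQ_surjective _ x
    rw [← map_smul]
    exact (hπ _).2 ⟨x.1, rfl⟩
  · intro s x hs h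
    obtain ⟨x, rfl⟩ := Submodule.mkQ_surjective _ x
    rw [← map_smul] at h
    obtain ⟨y, hy⟩ := (hπ _).1 h
    obtain ⟨z, hz⟩ := exists_eq_smul (p := p) (x := x.1) fun i => hp.dvd_of_mul hs
      ⟨y i, (congrFun (congrArg Subtype.val hy) i).symm⟩
    exact (hπ _).2 ⟨z, Subtype.ext hz.symm⟩

/-- Finitely presented modules killed by a power of `p` have finite free resolutions. -/
theorem hasFiniteFreeResolution_of_pow_smul_eq_zero (hp : IsValuativeAt p) (n : ℕ) :
    ∀ {Q : Type v} [AddCommGroup Q] [Module A Q] [Module.FinitePresentation A Q],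
      (∀ x : Q, p ^ n • x = 0) → HasFiniteFreeResolution A Q := by
  induction n with
  | zero =>
    intro Q _ _ _ hQ
    have : Subsingleton Q := subsingleton_of_forall_eq 0 fun x => by simpa using hQ x
    exact .of_subsingleton
  | succ n ih =>
    intro Q _ _ _ hQ
    let R := LinearMap.range (LinearMap.lsmul A Q p)
    have hfg : R.FG := Module.Finite.iff_fg.1 (Module.Finite.range _)
    have : Module.FinitePresentation A (Q ⧸ R) :=
      Module.finitePresentation_of_surjective R.mkQ R.mkQ_surjective (by rwa [R.ker_mkQ])
    have h₂ : HasFiniteFreeResolution A (Q ⧸ R) :=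
      hp.hasFiniteFreeResolution_of_finitePresentation_of_smul_eq_zero fun x => by
        obtain ⟨x, rfl⟩ := R.mkQ_surjective x
        rw [← map_smul]
        exact (Submodule.Quotient.mk_eq_zero R).2 ⟨x, rfl⟩
    have hex : Function.Exact R.subtype R.mkQ := LinearMap.exact_subtype_mkQ R
    -- Finite presentation passes to `pQ` because `Q / pQ` is resolved; the induction needs it.
    have : Module.FinitePresentation A R :=
      h₂.finitePresentation_of_exact R.subtype R.mkQ R.subtype_injective hex R.mkQ_surjective
    refine .extension R.subtype R.mkQ R.subtype_injective hex R.mkQ_surjective (ih ?_) h₂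
    rintro ⟨_, x, rfl⟩
    refine Subtype.ext ?_
    simpa [smul_smul, ← pow_succ] using hQ x

/-- Finite modules killed by a power of `p` and without torsion outside `p` have finite free
resolutions. -/
theorem hasFiniteFreeResolution_of_torsionFreeOutside (hp : IsValuativeAt p) (n : ℕ) :
    ∀ {Q : Type v} [AddCommGroup Q] [Module A Q] [Module.Finite A Q],
      (∀ x : Q, p ^ n • x = 0) → IsTorsionFreeOutside p Q → HasFiniteFreeResolution A Q := by
  induction n with
  | zero =>
    intro Q _ _ _ hQ _
    have : Subsingleton Q := subsingleton_of_forall_eq 0 fun x => by simpa using hQ x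
    exact .of_subsingleton
  | succ n ih =>
    intro Q _ _ _ hQ htf
    -- Filtering by `p ^ n Q` and the kernel of `p ^ n`, both submodules of `Q` up to isomorphism,
    -- preserves the absence of torsion outside `p`; the quotient `Q / pQ` could acquire such
    -- torsion.
    let φ := LinearMap.lsmul A Q (p ^ n)
    have hφ : ∀ x, φ x = p ^ n • x := fun x => rfl
    have h₂ : HasFiniteFreeResolution A (LinearMap.range φ) := by
      refine hp.hasFiniteFreeResolution_of_smul_eq_zero ?_ ?_
      · rintro ⟨_, x, rfl⟩
        refine Subtype.ext ?_
        simpa [hφ, smul_smul, ← pow_succ'] using hQ x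
      · exact fun s x hs h => Subtype.ext (htf s x hs (congrArg Subtype.val h))
    have := h₂.finitePresentation
    have : Module.Finite A (LinearMap.ker φ) := Module.Finite.iff_fg.2 (by
      rw [← LinearMap.ker_rangeRestrict]
      exact Module.FinitePresentation.fg_ker _ φ.surjective_rangeRestrict)
    refine .extension (LinearMap.ker φ).subtype φ.rangeRestrict (Submodule.subtype_injective _)
      ?_ φ.surjective_rangeRestrict (ih (fun x => Subtype.ext x.2) ?_) h₂
    · rw [LinearMap.exact_iff, LinearMap.ker_rangeRestrict, Submodule.range_subtype]
    · exact fun s x hs h => Subtype.ext (htf s x hs (congrArg Subtype.val h))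

end IsValuativeAt

end PadicValued

/-! ### Lattices, saturation, and modules over `A[1/p]`. -/

section Lattices

variable {A : Type u} [CommRing A]

/-- The elements of `L` with a multiple in `N` by a scalar not divisible by `p`. -/
def Submodule.saturationOutside {p : A} (hp : Prime p) {L : Type*} [AddCommGroup L] [Module A L]
    (N : Submodule A L) : Submodule A L where
  carrier := {x | ∃ s : A, ¬ p ∣ s ∧ s • x ∈ N}
  zero_mem' := ⟨1, fun h => hp.not_isUnit (isUnit_of_dvd_one h), by simp⟩
  add_mem' := by
    rintro x y ⟨s, hs, hx⟩ ⟨t, ht, hy⟩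
    refine ⟨s * t, fun h => (hp.dvd_or_dvd h).elim hs ht, ?_⟩
    rw [smul_add]
    refine N.add_mem ?_ ?_
    · rw [mul_comm, mul_smul]
      exact N.smul_mem _ hx
    · rw [mul_smul]
      exact N.smul_mem _ hy
  smul_mem' := by
    rintro a x ⟨s, hs, hx⟩
    exact ⟨s, hs, by rw [smul_comm]; exact N.smul_mem _ hx⟩

theorem Submodule.le_saturationOutside {p : A} (hp : Prime p) {L : Type*} [AddCommGroup L]
    [Module A L] (N : Submodule A L) : N ≤ N.saturationOutside hp :=
  fun x hx => ⟨1, fun h => hp.not_isUnit (isUnit_of_dvd_one h), by simpa using hx⟩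

theorem Submodule.FG.exists_smul_mem {L : Type*} [AddCommGroup L] [Module A L] (S : Submonoid A)
    {N : Submodule A L} (hN : N.FG) (P : Submodule A L) (h : ∀ x ∈ N, ∃ s ∈ S, s • x ∈ P) :
    ∃ s ∈ S, ∀ x ∈ N, s • x ∈ P := by
  induction N, hN using Submodule.fg_induction with
  | singleton x =>
    obtain ⟨s, hs, hx⟩ := h x (Submodule.mem_span_singleton_self x)
    refine ⟨s, hs, fun y hy => ?_⟩
    obtain ⟨a, rfl⟩ := Submodule.mem_span_singleton.1 hy
    rw [smul_comm]
    exact P.smul_mem _ hx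
  | sup N₁ N₂ _ _ h₁ h₂ =>
    obtain ⟨s, hs, h₁⟩ := h₁ fun x hx => h x (Submodule.mem_sup_left hx)
    obtain ⟨t, ht, h₂⟩ := h₂ fun x hx => h x (Submodule.mem_sup_right hx)
    refine ⟨s * t, S.mul_mem hs ht, fun x hx => ?_⟩
    obtain ⟨y, hy, z, hz, rfl⟩ := Submodule.mem_sup.1 hx
    rw [smul_add]
    refine P.add_mem ?_ ?_
    · rw [mul_comm, mul_smul]
      exact P.smul_mem _ (h₁ y hy)
    · rw [mul_smul]
      exact P.smul_mem _ (h₂ z hz)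

theorem Submodule.FG.exists_pow_smul_mem {L : Type*} [AddCommGroup L] [Module A L] (p : A)
    {N : Submodule A L} (hN : N.FG) (P : Submodule A L) (h : ∀ x ∈ N, ∃ n : ℕ, p ^ n • x ∈ P) :
    ∃ n : ℕ, ∀ x ∈ N, p ^ n • x ∈ P := by
  obtain ⟨_, ⟨n, rfl⟩, hn⟩ := hN.exists_smul_mem (Submonoid.powers p) P
    fun x hx => (h x hx).elim fun n hn => ⟨_, ⟨n, rfl⟩, hn⟩
  exact ⟨n, hn⟩

namespace IsValuativeAt

variable {p : A} {L : Type v} [AddCommGroup L] [Module A L]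

theorem exists_smul_eq_of_free (hp : IsValuativeAt p) {F : Type*} [AddCommGroup F] [Module A F]
    [Module.Free A F] {s : A} (hs : ¬ p ∣ s) {y z : F} (h : s • y = p • z) :
    ∃ w, y = p • w := by
  let b := Module.Free.chooseBasis A F
  have hdvd : ∀ i, p ∣ b.repr y i := fun i => hp.dvd_of_mul hs ⟨b.repr z i, by
    have := congrArg (fun x => b.repr x i) h
    simpa using this⟩
  choose c hc using hdvd
  classical
  refine ⟨b.repr.symm (Finsupp.onFinset (b.repr y).support c fun i hi => ?_), ?_⟩
  · rw [Finsupp.mem_support_iff, hc]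
    exact fun h => hi (hp.mul_eq_zero _ h)
  · apply b.repr.injective
    ext i
    simp [hc]

/-- Free lattices are saturated: if `s • x ∈ F` and `p ^ (n + 1) • x ∈ F`, then `s` times the latter
lies in `pF`. As `F / pF` has no torsion outside `p`, one factor `p` can be removed. -/
theorem saturationOutside_le_of_free (hp : IsValuativeAt p)
    (hL : Function.Bijective fun x : L => p • x) (F : Submodule A L) [Module.Free A F]
    (hF : ∀ x : L, ∃ n : ℕ, p ^ n • x ∈ F) : F.saturationOutside hp.prime ≤ F := by
  rintro x ⟨s, hs, hx⟩
  obtain ⟨n, hn⟩ := hF x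
  induction n with
  | zero => simpa using hn
  | succ n ih =>
    obtain ⟨⟨w, hw⟩, h⟩ := hp.exists_smul_eq_of_free hs
      (y := (⟨p ^ (n + 1) • x, hn⟩ : F)) (z := ⟨p ^ n • s • x, F.smul_mem _ hx⟩)
      (Subtype.ext (by simp only [Submodule.coe_smul, smul_smul]; congr 1; ring))
    refine ih ?_
    have : p • p ^ n • x = p • w := by
      rw [smul_smul, ← pow_succ']
      exact congrArg Subtype.val h
    rwa [hL.injective this]

/-- A finite submodule of a finite free module `F` containing `p ^ m F` has a finite free
resolution. -/
theorem hasFiniteFreeResolution_of_le_free (hp : IsValuativeAt p) {N F : Submodule A L}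
    [Module.Free A F] [Module.Finite A F] (hNF : N ≤ F) (hN : N.FG) {m : ℕ}
    (hm : ∀ x ∈ F, p ^ m • x ∈ N) : HasFiniteFreeResolution A N := by
  let e := Submodule.submoduleOfEquivOfLe hNF
  have : Module.Finite A N := Module.Finite.iff_fg.2 hN
  have hfg : (N.submoduleOf F).FG := Module.Finite.iff_fg.1 (Module.Finite.equiv e.symm)
  have := Module.finitePresentation_of_projective A F
  have : Module.FinitePresentation A (F ⧸ N.submoduleOf F) :=
    Module.finitePresentation_of_surjective _ (Submodule.mkQ_surjective _)
      (by rwa [Submodule.ker_mkQ])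
  refine .of_equiv e (.of_exact_left _ _ (Submodule.subtype_injective _)
    (LinearMap.exact_subtype_mkQ _) (Submodule.mkQ_surjective _) (.of_free A F)
    (hp.hasFiniteFreeResolution_of_pow_smul_eq_zero m fun x => ?_))
  obtain ⟨x, rfl⟩ := Submodule.mkQ_surjective _ x
  rw [← map_smul]
  exact (Submodule.Quotient.mk_eq_zero _).2 (hm x x.2)

/-- The saturation of a submodule of a finite free module `F` containing `p ^ m F` is finite. -/
theorem finite_saturationOutside (hp : IsValuativeAt p) {N F : Submodule A L} [Module.Finite A F]
    [Module.Free A F] (hF : N.saturationOutside hp.prime ≤ F) {m : ℕ}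
    (hm : ∀ x ∈ F, p ^ m • x ∈ N) : Module.Finite A (N.saturationOutside hp.prime) := by
  let N' := N.saturationOutside hp.prime
  let e := Submodule.submoduleOfEquivOfLe hF
  -- Saturation removes the torsion of `F / N'` outside `p`. The quotient is therefore finitely
  -- presented, which makes `N'` finite.
  have h : HasFiniteFreeResolution A (F ⧸ N'.submoduleOf F) := by
    refine hp.hasFiniteFreeResolution_of_torsionFreeOutside m (fun x => ?_) fun s x hs h => ?_
    · obtain ⟨x, rfl⟩ := Submodule.mkQ_surjective _ x
      rw [← map_smul]
      exact (Submodule.Quotient.mk_eq_zero _).2 (N.le_saturationOutside hp.prime (hm x x.2))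
    · obtain ⟨x, rfl⟩ := Submodule.mkQ_surjective _ x
      rw [← map_smul] at h
      obtain ⟨t, ht, h⟩ := (Submodule.Quotient.mk_eq_zero _).1 h
      refine (Submodule.Quotient.mk_eq_zero _).2
        ⟨t * s, fun h => (hp.prime.dvd_or_dvd h).elim ht hs, ?_⟩
      rw [mul_smul]
      exact h
  have := h.finitePresentation
  have hfg := Module.FinitePresentation.fg_ker _ (Submodule.mkQ_surjective (N'.submoduleOf F))
  rw [Submodule.ker_mkQ] at hfg
  have := Module.Finite.iff_fg.2 hfg
  exact Module.Finite.equiv e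

/-- If `s • x = p • y` in the saturation, divide `x` by `p` in `L`: `x = p • z` with `s • z = y`, so
`z` is in the saturation too. -/
theorem free_saturationOutside (hp : IsValuativeAt p)
    (hL : Function.Bijective fun x : L => p • x) (N : Submodule A L)
    [Module.Finite A (N.saturationOutside hp.prime)] :
    Module.Free A (N.saturationOutside hp.prime) := by
  refine hp.free_of_torsionFree (fun x hx => Subtype.ext (hL.injective ?_)) ?_
  · exact (congrArg Subtype.val hx).trans (smul_zero p).symm
  · rintro s ⟨x, hx⟩ ⟨y, hy⟩ hs h
    obtain ⟨z, rfl⟩ := hL.surjective x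
    have h : s • p • z = p • y := congrArg Subtype.val h
    rw [smul_comm] at h
    have hy' : s • z = y := hL.injective h
    obtain ⟨t, ht, hty⟩ := hy
    rw [← hy'] at hty
    refine ⟨⟨z, t * s, fun h => (hp.prime.dvd_or_dvd h).elim ht hs, ?_⟩, rfl⟩
    rwa [mul_smul]

theorem smul_pow_bijective (hL : Function.Bijective fun x : L => p • x) (k : ℕ) :
    Function.Bijective (LinearMap.lsmul A L (p ^ k)) := by
  induction k with
  | zero =>
    convert Function.bijective_id (α := L) using 1
    ext x
    simp
  | succ k ih =>
    convert hL.comp ih using 1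
    ext x
    simp [pow_succ', mul_smul]

/-- Multiplication by `p ^ k` from `p ^ (-k) F` to `F`. -/
noncomputable def comapSMulPowEquiv (hL : Function.Bijective fun x : L => p • x) (k : ℕ)
    (F : Submodule A L) : F.comap (LinearMap.lsmul A L (p ^ k)) ≃ₗ[A] F :=
  (LinearEquiv.ofBijective _ (smul_pow_bijective hL k)).submoduleMap _ ≪≫ₗ
    LinearEquiv.ofEq _ _ (Submodule.map_comap_eq_of_surjective (smul_pow_bijective hL k).2 F)

end IsValuativeAt

section Away

variable {p : A} (B : Type w) [CommRing B] [Algebra A B]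

theorem IsLocalization.Away.smul_bijective (p : A) [IsLocalization.Away p B] (L : Type v)
    [AddCommGroup L] [Module A L] [Module B L] [IsScalarTower A B L] :
    Function.Bijective fun x : L => p • x := by
  obtain ⟨u, hu⟩ := IsLocalization.Away.algebraMap_isUnit (S := B) p
  convert MulAction.bijective u using 1
  ext x
  rw [Units.smul_def, hu, algebraMap_smul]

variable (A) in
/-- The lattice `A ^ d` in `B ^ d`. -/
def standardLattice (d : ℕ) : Submodule A (Fin d → B) :=
  LinearMap.range ((Algebra.linearMap A B).compLeft (Fin d))

theorem IsValuativeAt.algebraMap_injective (hp : IsValuativeAt p) [IsLocalization.Away p B] :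
    Function.Injective (algebraMap A B) := by
  rw [injective_iff_map_eq_zero]
  intro x hx
  obtain ⟨⟨_, n, rfl⟩, hn⟩ := (IsLocalization.map_eq_zero_iff (Submonoid.powers p) B x).1 hx
  change p ^ n * x = 0 at hn
  induction n with
  | zero => simpa using hn
  | succ n ih =>
    rw [pow_succ', mul_assoc] at hn
    exact ih (hp.mul_eq_zero _ hn)

/-- The lattice `A ^ d` in `B ^ d` is free. -/
noncomputable def IsValuativeAt.standardLatticeEquiv (hp : IsValuativeAt p)
    [IsLocalization.Away p B] (d : ℕ) : (Fin d → A) ≃ₗ[A] standardLattice A B d :=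
  LinearEquiv.ofInjective _ fun _ _ h =>
    funext fun i => hp.algebraMap_injective B (congrFun h i)

theorem exists_pow_smul_mem_standardLattice (p : A) [IsLocalization.Away p B] {d : ℕ}
    (x : Fin d → B) : ∃ n : ℕ, p ^ n • x ∈ standardLattice A B d := by
  choose n a h using fun i => IsLocalization.Away.surj p (x i)
  refine ⟨∑ i, n i, fun i => p ^ (∑ j, n j - n i) * a i, funext fun i => ?_⟩
  have hi : n i ≤ ∑ j, n j := Finset.single_le_sum (fun _ _ => Nat.zero_le _) (Finset.mem_univ i)
  change algebraMap A B _ = p ^ _ • x i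
  rw [map_mul, ← h, Algebra.smul_def, map_pow, map_pow, mul_comm (x i), ← mul_assoc, ← pow_add,
    Nat.sub_add_cancel hi]

/-- A finite submodule of a finite free `A[1/p]`-module is contained in a finite free
`A`-lattice. -/
theorem IsValuativeAt.exists_lattice (hp : IsValuativeAt p) [IsLocalization.Away p B]
    {L : Type v} [AddCommGroup L] [Module A L] [Module B L] [IsScalarTower A B L]
    [Module.Free B L] [Module.Finite B L] {N : Submodule A L} (hN : N.FG) :
    ∃ F : Submodule A L, Module.Free A F ∧ Module.Finite A F ∧ N ≤ F ∧
      ∀ x, ∃ n : ℕ, p ^ n • x ∈ F := by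
  let b := (Module.Free.chooseBasis B L).reindex (Fintype.equivFin _)
  let e := b.equivFun.restrictScalars A
  have hL := IsLocalization.Away.smul_bijective B p L
  let F₀ := (standardLattice A B _).map e.symm.toLinearMap
  have hF₀ : ∀ x, x ∈ F₀ ↔ e x ∈ standardLattice A B _ :=
    fun x => Submodule.mem_map_equiv _
  let e₀ := hp.standardLatticeEquiv B _ ≪≫ₗ e.symm.submoduleMap (standardLattice A B _)
  have h₀ : ∀ x, ∃ n : ℕ, p ^ n • x ∈ F₀ := fun x => by
    simpa only [hF₀, map_smul] using exists_pow_smul_mem_standardLattice B p (e x)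
  -- As `p ^ k N ⊆ F₀`, the lattice `p ^ (-k) F₀` contains `N`.
  obtain ⟨k, hk⟩ := hN.exists_pow_smul_mem p F₀ fun x _ => h₀ x
  let e₁ := e₀ ≪≫ₗ (IsValuativeAt.comapSMulPowEquiv hL k F₀).symm
  refine ⟨F₀.comap (LinearMap.lsmul A L (p ^ k)), .of_equiv e₁, .equiv e₁, hk, fun x => ?_⟩
  obtain ⟨n, hn⟩ := h₀ x
  refine ⟨n, ?_⟩
  rw [Submodule.mem_comap, LinearMap.lsmul_apply]
  exact F₀.smul_mem _ hn

variable {M : Type v} [AddCommGroup M] [Module A M] [Module.FinitePresentation A M]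
  {L : Type*} [AddCommGroup L] [Module A L] [Module B L] [IsScalarTower A B L]
  [Module.Free B L] [Module.Finite B L]

/-- The corestriction of `f` to the saturation of its range. -/
def LinearMap.toSaturationOutside {p : A} (hp : Prime p) {M L : Type*} [AddCommGroup M]
    [Module A M] [AddCommGroup L] [Module A L] (f : M →ₗ[A] L) :
    M →ₗ[A] (LinearMap.range f).saturationOutside hp :=
  f.codRestrict _ fun x => Submodule.le_saturationOutside hp _ ⟨x, rfl⟩

variable (hp : IsValuativeAt p) [IsLocalization.Away p B] (f : M →ₗ[A] L) [IsLocalizedModule (Submonoid.powers p) f]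

theorem IsLocalizedModule.Away.exists_pow_smul_mem_range (p : A) {M L : Type*} [AddCommGroup M]
    [Module A M] [AddCommGroup L] [Module A L] (f : M →ₗ[A] L)
    [IsLocalizedModule (Submonoid.powers p) f] (x : L) :
    ∃ n : ℕ, p ^ n • x ∈ LinearMap.range f := by
  obtain ⟨⟨y, _, n, rfl⟩, h⟩ := IsLocalizedModule.surj (Submonoid.powers p) f x
  exact ⟨n, y, h.symm⟩

theorem IsLocalizedModule.Away.exists_pow_smul_eq_zero (p : A) {M L : Type*} [AddCommGroup M]
    [Module A M] [AddCommGroup L] [Module A L] (f : M →ₗ[A] L)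
    [IsLocalizedModule (Submonoid.powers p) f] {x : M} (hx : f x = 0) :
    ∃ n : ℕ, p ^ n • x = 0 := by
  obtain ⟨⟨_, n, rfl⟩, h⟩ := IsLocalizedModule.exists_of_eq (S := Submonoid.powers p) (f := f)
    (hx.trans (map_zero f).symm)
  exact ⟨n, by simpa [Submonoid.smul_def] using h⟩

include hp B in
/-- The structure of a finitely presented module that becomes finite free after inverting `p`. -/
theorem IsValuativeAt.structure_of_free_away :
    HasFiniteFreeResolution A M ∧
    (HasFiniteFreeResolution A (LinearMap.ker f) ∧
      ∃ n : ℕ, ∀ x : LinearMap.ker f, p ^ n • x = 0) ∧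
    (Module.Finite A ((LinearMap.range f).saturationOutside hp.prime) ∧
      Module.Free A ((LinearMap.range f).saturationOutside hp.prime)) ∧
    HasFiniteFreeResolution A ((LinearMap.range f).saturationOutside hp.prime ⧸
      LinearMap.range (f.toSaturationOutside hp.prime)) ∧
    (∃ n : ℕ, ∀ x : (LinearMap.range f).saturationOutside hp.prime ⧸
      LinearMap.range (f.toSaturationOutside hp.prime), p ^ n • x = 0) ∧
    ∃ s : A, ¬ p ∣ s ∧ ∀ x : (LinearMap.range f).saturationOutside hp.prime ⧸
      LinearMap.range (f.toSaturationOutside hp.prime), s • x = 0 := by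
  have hL := IsLocalization.Away.smul_bijective B p L
  let N := LinearMap.range f
  have hN : N.FG := Module.Finite.iff_fg.1 (Module.Finite.range f)
  obtain ⟨F, _, _, hNF, hF⟩ := hp.exists_lattice B hN
  obtain ⟨m, hm⟩ := (Module.Finite.iff_fg.1 ‹Module.Finite A F›).exists_pow_smul_mem p N
    fun x _ => IsLocalizedModule.Away.exists_pow_smul_mem_range p f x
  have hNres : HasFiniteFreeResolution A N := hp.hasFiniteFreeResolution_of_le_free hNF hN hm
  have hex : Function.Exact (LinearMap.ker f).subtype f.rangeRestrict := by
    rw [LinearMap.exact_iff, LinearMap.ker_rangeRestrict, Submodule.range_subtype]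
  have : Module.FinitePresentation A (LinearMap.ker f) :=
    hNres.finitePresentation_of_exact _ _ (Submodule.subtype_injective _) hex
      f.surjective_rangeRestrict
  obtain ⟨n, hn⟩ := (Module.Finite.iff_fg.1
    (inferInstance : Module.Finite A (LinearMap.ker f))).exists_pow_smul_mem p ⊥ fun x hx => by
      simpa using IsLocalizedModule.Away.exists_pow_smul_eq_zero p f (x := x) hx
  have hn : ∀ x : LinearMap.ker f, p ^ n • x = 0 := fun x => Subtype.ext (hn x x.2)
  have hker : HasFiniteFreeResolution A (LinearMap.ker f) :=
    hp.hasFiniteFreeResolution_of_pow_smul_eq_zero n hn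
  have hN'F : N.saturationOutside hp.prime ≤ F := fun x hx =>
    hp.saturationOutside_le_of_free hL F hF (hx.imp fun s h => ⟨h.1, hNF h.2⟩)
  have hfin : Module.Finite A (N.saturationOutside hp.prime) :=
    hp.finite_saturationOutside hN'F hm
  have hfree : Module.Free A (N.saturationOutside hp.prime) := hp.free_saturationOutside hL N
  let j := f.toSaturationOutside hp.prime
  have hj : ∀ x : N.saturationOutside hp.prime, (x : L) ∈ N → x ∈ LinearMap.range j := by
    rintro x ⟨y, hy⟩
    exact ⟨y, Subtype.ext hy⟩
  have hpow : ∀ x : N.saturationOutside hp.prime ⧸ LinearMap.range j, p ^ m • x = 0 := by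
    intro x
    obtain ⟨x, rfl⟩ := Submodule.mkQ_surjective _ x
    rw [← map_smul]
    exact (Submodule.Quotient.mk_eq_zero _).2 (hj _ (hm x (hN'F x.2)))
  have := Module.finitePresentation_of_projective A (N.saturationOutside hp.prime)
  have : Module.FinitePresentation A (N.saturationOutside hp.prime ⧸ LinearMap.range j) :=
    Module.finitePresentation_of_surjective _ (Submodule.mkQ_surjective _) (by
      rw [Submodule.ker_mkQ]
      exact Module.Finite.iff_fg.1 (Module.Finite.range j))
  refine ⟨.extension _ _ (Submodule.subtype_injective _) hex f.surjective_rangeRestrict hker hNres,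
    ⟨hker, n, hn⟩, ⟨hfin, hfree⟩, hp.hasFiniteFreeResolution_of_pow_smul_eq_zero m hpow,
    ⟨m, hpow⟩, ?_⟩
  have := (Ideal.span_singleton_prime hp.prime.ne_zero).2 hp.prime
  -- Each element of the finite saturation has its own multiplier outside the prime ideal `(p)`; a
  -- product over generators works for all.
  obtain ⟨s, hs, h⟩ := (Module.Finite.iff_fg.1 hfin).exists_smul_mem
    (Ideal.span {p} : Ideal A).primeCompl
    N
    fun x hx => hx.imp fun s h => ⟨fun h' => h.1 (Ideal.mem_span_singleton.1 h'), h.2⟩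
  refine ⟨s, fun h' => hs (Ideal.mem_span_singleton.2 h'), fun x => ?_⟩
  obtain ⟨x, rfl⟩ := Submodule.mkQ_surjective _ x
  rw [← map_smul]
  exact (Submodule.Quotient.mk_eq_zero _).2 (hj _ (h x x.2))

end Away

/-- Finite projective modules over `A[1/p]` are free. -/
theorem IsValuativeAt.free_of_projective_away {p : A} (hp : IsValuativeAt p) (B : Type w)
    [CommRing B] [Algebra A B] [IsLocalization.Away p B] (N : Type v) [AddCommGroup N]
    [Module B N] [Module.Finite B N] [Module.Projective B N] : Module.Free B N := by
  let _ : Module A N := Module.compHom N (algebraMap A B)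
  have : IsScalarTower A B N := IsScalarTower.of_algebraMap_smul fun _ _ => rfl
  obtain ⟨d, π, hπ⟩ := Module.Finite.exists_fin' B N
  obtain ⟨i, hi⟩ := Module.projective_lifting_property π LinearMap.id hπ
  replace hi : ∀ x, π (i x) = x := LinearMap.congr_fun hi
  have hN := IsLocalization.Away.smul_bijective B p N
  have hB := IsLocalization.Away.smul_bijective B p (Fin d → B)
  let F := standardLattice A B d
  have hFfree : Module.Free A F := .of_equiv (hp.standardLatticeEquiv B d)
  have hFfin : Module.Finite A F := .equiv (hp.standardLatticeEquiv B d)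
  have hFfg := Module.Finite.iff_fg.1 hFfin
  let M := F.map (π.restrictScalars A)
  let I := M.map (i.restrictScalars A)
  have hMfg : M.FG := hFfg.map _
  have hIfg : I.FG := hMfg.map _
  have : Module.Finite A M := Module.Finite.iff_fg.2 hMfg
  obtain ⟨k, hk⟩ := hIfg.exists_pow_smul_mem p F
    fun x _ => exists_pow_smul_mem_standardLattice B p x
  let e₁ := (comapSMulPowEquiv hB k F).symm
  have : Module.Free A (F.comap (LinearMap.lsmul A (Fin d → B) (p ^ k))) := .of_equiv e₁
  have : Module.Finite A (F.comap (LinearMap.lsmul A (Fin d → B) (p ^ k))) := .equiv e₁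
  have hle : I ⊔ F ≤ F.comap (LinearMap.lsmul A (Fin d → B) (p ^ k)) :=
    sup_le hk fun x hx => F.smul_mem _ hx
  -- `I ⊔ F` lies between `F` and `p ^ (-k) F`, so it and then `(I ⊔ F) / F` are finitely presented.
  have hres := hp.hasFiniteFreeResolution_of_le_free hle (hIfg.sup hFfg)
    (m := k) fun x hx => Submodule.mem_sup_right hx
  have := hres.finitePresentation
  let F' := F.submoduleOf (I ⊔ F)
  have : Module.FinitePresentation A (↥(I ⊔ F) ⧸ F') :=
    Module.finitePresentation_of_surjective _ (Submodule.mkQ_surjective _) (by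
      rw [Submodule.ker_mkQ]
      exact Module.Finite.iff_fg.1
        (Module.Finite.equiv (Submodule.submoduleOfEquivOfLe (le_sup_right : F ≤ I ⊔ F)).symm))
  let φ : M →ₗ[A] ↥(I ⊔ F) ⧸ F' := F'.mkQ ∘ₗ
    ((i.restrictScalars A) ∘ₗ M.subtype).codRestrict (I ⊔ F)
      fun x => Submodule.mem_sup_left ⟨x, x.2, rfl⟩
  have hφ : ∀ x, φ x = 0 ↔ i x ∈ F := fun x => Submodule.Quotient.mk_eq_zero _
  have hφsurj : Function.Surjective φ := by
    intro y
    obtain ⟨⟨y, hy⟩, rfl⟩ := Submodule.mkQ_surjective _ y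
    obtain ⟨_, ⟨x, hx, rfl⟩, z, hz, rfl⟩ := Submodule.mem_sup.1 hy
    refine ⟨⟨x, hx⟩, (Submodule.Quotient.eq _).2 ?_⟩
    change i x - (i x + z) ∈ F
    rw [sub_add_cancel_left]
    exact F.neg_mem hz
  -- `P` is the intersection of `N` with `A ^ d`. Since `x = π (i x)`, it lies in `M = π F`, where
  -- it is the kernel of `φ`; this kernel is finite because the target of `φ` is finitely presented.
  let P := F.comap (i.restrictScalars A)
  have hP : P = (LinearMap.ker φ).map M.subtype := by
    ext x
    constructor
    · intro hx
      exact ⟨⟨x, i x, hx, hi x⟩, (hφ _).2 hx, rfl⟩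
    · rintro ⟨x, hx, rfl⟩
      exact (hφ _).1 hx
  have hPfin : Module.Finite A P := Module.Finite.iff_fg.2 (by
    rw [hP]
    exact (Module.FinitePresentation.fg_ker φ hφsurj).map _)
  -- `P / pP` inherits torsion-freeness from `F / pF`: if `i x ∈ pF` and `x = p • z`, then `i z ∈
  -- F`, so `z ∈ P`.
  have hPfree : Module.Free A P := by
    refine hp.free_of_torsionFree (fun x hx => Subtype.ext (hN.injective ?_)) ?_
    · exact (congrArg Subtype.val hx).trans (smul_zero p).symm
    · rintro s ⟨x, hx⟩ ⟨y, hy⟩ hs h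
      obtain ⟨z, rfl⟩ := hN.surjective x
      obtain ⟨⟨w, hw⟩, hw'⟩ := hp.exists_smul_eq_of_free hs (y := (⟨_, hx⟩ : F))
        (z := ⟨_, hy⟩) (Subtype.ext (by
          have := congrArg (fun x => (i.restrictScalars A) x.1) h
          simpa using this))
      have hw' : (i.restrictScalars A) (p • z) = p • w := congrArg Subtype.val hw'
      rw [map_smul] at hw'
      refine ⟨⟨z, ?_⟩, rfl⟩
      rw [← hB.injective hw'] at hw
      exact hw
  have : IsLocalizedModule (Submonoid.powers p) P.subtype := by
    refine ⟨?_, fun y => ?_, fun h => ⟨1, by rw [Subtype.ext h]⟩⟩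
    · rintro ⟨_, n, rfl⟩
      exact (Module.End.isUnit_iff _).2 (smul_pow_bijective hN n)
    · obtain ⟨n, hn⟩ := exists_pow_smul_mem_standardLattice B p (i y)
      refine ⟨⟨⟨p ^ n • y, ?_⟩, p ^ n, n, rfl⟩, rfl⟩
      change (i.restrictScalars A) _ ∈ F
      rwa [map_smul]
  exact Module.free_of_isLocalizedModule (Submonoid.powers p) P.subtype

end Lattices

/-! ### The tilt is a valuation ring, and `𝔸_inf` satisfies `IsValuativeAt`. -/

section Tilt

namespace IntegerRing

variable {C : Type u} [NormedField C] [IsUltrametricDist C]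

theorem mem_iff {x : C} : x ∈ IntegerRing C ↔ ‖x‖ ≤ 1 := by
  rw [Valuation.mem_valuationSubring_iff, NormedField.valuation_apply, ← NNReal.coe_le_coe]
  rfl

theorem norm_le_one (x : IntegerRing C) : ‖(x : C)‖ ≤ 1 :=
  mem_iff.1 x.2

theorem dvd_iff {x y : IntegerRing C} : x ∣ y ↔ ‖(y : C)‖ ≤ ‖(x : C)‖ := by
  constructor
  · rintro ⟨z, rfl⟩
    rw [MulMemClass.coe_mul, norm_mul]
    exact mul_le_of_le_one_right (norm_nonneg _) (norm_le_one z)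
  · intro h
    obtain rfl | hx := eq_or_ne x 0
    · rw [ZeroMemClass.coe_zero, norm_zero] at h
      exact (Subtype.ext (norm_le_zero_iff.1 h) : y = 0) ▸ dvd_rfl
    · have hx : (x : C) ≠ 0 := fun h => hx (Subtype.ext h)
      refine ⟨⟨y / x, mem_iff.2 ?_⟩, Subtype.ext (mul_div_cancel₀ _ hx).symm⟩
      rw [norm_div]
      exact div_le_one_of_le₀ h (norm_nonneg _)

/-- The ring of integers of a complete field is complete for the topology of a nonzero
topologically nilpotent element. -/
theorem isAdicComplete [CompleteSpace C] (a : IntegerRing C) (ha : ¬ IsUnit a) (ha₀ : a ≠ 0) :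
    IsAdicComplete (Ideal.span {a}) (IntegerRing C) := by
  have ha₁ : ‖(a : C)‖ < 1 := by
    refine lt_of_le_of_ne (norm_le_one a) fun h => ha (isUnit_of_dvd_one (dvd_iff.2 ?_))
    rw [h, OneMemClass.coe_one, norm_one]
  have ha₂ : 0 < ‖(a : C)‖ := norm_pos_iff.2 fun h => ha₀ (Subtype.ext h)
  have hmod : ∀ (n : ℕ) (x y : IntegerRing C),
      x ≡ y [SMOD (Ideal.span {a} ^ n • ⊤ : Submodule (IntegerRing C) (IntegerRing C))] ↔
        ‖(x : C) - y‖ ≤ ‖(a : C)‖ ^ n := by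
    intro n x y
    rw [SModEq.sub_mem, smul_eq_mul, Ideal.mul_top, Ideal.span_singleton_pow,
      Ideal.mem_span_singleton, dvd_iff, SubmonoidClass.coe_pow, norm_pow]
    rfl
  have htend := tendsto_pow_atTop_nhds_zero_of_lt_one ha₂.le ha₁
  refine { haus' := fun x hx => ?_, prec' := fun f hf => ?_ }
  · refine Subtype.ext (norm_le_zero_iff.1 (ge_of_tendsto' htend fun n => ?_))
    simpa using (hmod n x 0).1 (hx n)
  · have hf' : ∀ {m n}, m ≤ n → ‖(f m : C) - f n‖ ≤ ‖(a : C)‖ ^ m :=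
      fun h => (hmod _ _ _).1 (hf h)
    have hc : CauchySeq fun n => (f n : C) :=
      cauchySeq_of_le_tendsto_0' _ (fun n m h => by rw [dist_eq_norm]; exact hf' h) htend
    obtain ⟨l, hl⟩ := cauchySeq_tendsto_of_complete hc
    refine ⟨⟨l, mem_iff.2 (le_of_tendsto' hl.norm fun n => norm_le_one _)⟩, fun n => ?_⟩
    rw [hmod]
    exact le_of_tendsto (hl.const_sub _).norm
      (Filter.eventually_atTop.2 ⟨n, fun m hm => hf' hm⟩)

end IntegerRing

variable {p : ℕ} [Fact p.Prime] {C : Type u} [NormedField C] [IsUltrametricDist C]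
  [CharP (IsLocalRing.ResidueField (IntegerRing C)) p]

instance IntegerRing.isAdicComplete_span_natCast [CharZero C] [CompleteSpace C] :
    IsAdicComplete (Ideal.span {(p : IntegerRing C)}) (IntegerRing C) :=
  IntegerRing.isAdicComplete _ (Fact.out : ¬ IsUnit (p : IntegerRing C))
    fun h => (Fact.out : p.Prime).ne_zero
      (Nat.cast_injective (R := C) (by simpa using congrArg Subtype.val h))

namespace TiltRing

/-- The `p ^ n`-th root of an element of the tilt. -/
noncomputable abbrev root (n : ℕ) (x : TiltRing p C) : TiltRing p C :=
  (frobeniusEquiv (TiltRing p C) p).symm^[n] x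

theorem root_succ_pow (n : ℕ) (x : TiltRing p C) : root (n + 1) x ^ p = root n x := by
  rw [root, Function.iterate_succ_apply', ← frobenius_def, ← coe_frobeniusEquiv,
    RingEquiv.apply_symm_apply]

theorem ext {x y : TiltRing p C} (h : ∀ n, PreTilt.coeff n x = PreTilt.coeff n y) : x = y :=
  Perfection.ext h

variable [CharZero C] [CompleteSpace C]

/-- The norm of the untilt. -/
noncomputable def norm (x : TiltRing p C) : ℝ := ‖((PreTilt.untilt x : IntegerRing C) : C)‖

theorem norm_mul (x y : TiltRing p C) : norm (x * y) = norm x * norm y := by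
  simp only [norm, map_mul, MulMemClass.coe_mul, _root_.norm_mul]

theorem norm_one : norm (1 : TiltRing p C) = 1 := by
  simp only [norm, map_one, OneMemClass.coe_one, NormOneClass.norm_one]

theorem norm_pow (x : TiltRing p C) (n : ℕ) : norm (x ^ n) = norm x ^ n := by
  simp only [norm, map_pow, SubmonoidClass.coe_pow, _root_.norm_pow]

theorem norm_nonneg (x : TiltRing p C) : 0 ≤ norm x := _root_.norm_nonneg _

theorem norm_root_pow (n : ℕ) (x : TiltRing p C) : norm (root n x) ^ p ^ n = norm x := by
  rw [← norm_pow, norm, norm, map_pow, PreTilt.untilt_iterate_frobeniusEquiv_symm_pow]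

/-- The untilts of the `p`-power roots determine an element, so identities in the tilt can be
checked on elements of `𝒪`. -/
theorem coeff_eq (n : ℕ) (x : TiltRing p C) :
    PreTilt.coeff n x = Ideal.Quotient.mk _ (PreTilt.untilt (root n x)) := by
  rw [PreTilt.mk_untilt_eq_coeff_zero, PreTilt.coeff_iterate_frobeniusEquiv_symm, zero_add]

theorem norm_eq_zero {x : TiltRing p C} : norm x = 0 ↔ x = 0 := by
  have hpos : ∀ n, p ^ n ≠ 0 := fun n => pow_ne_zero n (Fact.out : p.Prime).ne_zero
  constructor
  · intro h
    refine ext fun n => ?_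
    have h₁ := norm_root_pow n x
    rw [h] at h₁
    have h₂ : PreTilt.untilt (root n x) = (0 : IntegerRing C) :=
      Subtype.ext (_root_.norm_eq_zero.1 (pow_eq_zero_iff (hpos n) |>.1 h₁))
    rw [coeff_eq, h₂, map_zero, map_zero]
  · rintro rfl
    -- Multiplicativity alone gives an idempotent norm. The value `1` is excluded because the untilt
    -- of `0` is divisible by the non-unit `p`.
    have h : norm (0 : TiltRing p C) = 0 ∨ norm (0 : TiltRing p C) = 1 := by
      have := norm_mul (0 : TiltRing p C) 0
      rw [mul_zero] at this
      by_cases h : norm (0 : TiltRing p C) = 0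
      · exact Or.inl h
      · exact Or.inr (mul_left_cancel₀ h (by rw [← this, mul_one]))
    refine h.resolve_right fun h => ?_
    have h₁ : (p : IntegerRing C) ∣ PreTilt.untilt (0 : TiltRing p C) := by
      rw [← Ideal.mem_span_singleton, ← Ideal.Quotient.eq_zero_iff_mem]
      exact (PreTilt.mk_untilt_eq_coeff_zero _).trans (map_zero _)
    refine (Fact.out : ¬ IsUnit (p : IntegerRing C)) (isUnit_of_dvd_unit h₁
      (isUnit_of_dvd_one (IntegerRing.dvd_iff.2 ?_)))
    rw [OneMemClass.coe_one, NormOneClass.norm_one]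
    exact h.ge

/-- Divisibility in the tilt is decided by the norm of the untilts. -/
theorem dvd_of_norm_le {x y : TiltRing p C} (h : norm x ≤ norm y) : y ∣ x := by
  have hp : p ≠ 0 := (Fact.out : p.Prime).ne_zero
  obtain rfl | hy := eq_or_ne y 0
  · rw [norm_eq_zero.2 rfl] at h
    rw [norm_eq_zero.1 (le_antisymm h (norm_nonneg x))]
  have hle : ∀ n, norm (root n x) ≤ norm (root n y) := fun n => by
    rw [← norm_root_pow n x, ← norm_root_pow n y] at h
    exact le_of_pow_le_pow_left₀ (pow_ne_zero n hp) (norm_nonneg _) h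
  have hy₀ : ∀ n, ((PreTilt.untilt (root n y) : IntegerRing C) : C) ≠ 0 := fun n h₀ => hy <| by
    rw [← norm_eq_zero, ← norm_root_pow n y, norm, h₀, norm_zero, zero_pow (pow_ne_zero n hp)]
  -- The quotients of the untilted roots lie in `𝒪` and form a system compatible with `p`-th powers,
  -- so their reductions define the quotient in the tilt.
  let z : ℕ → IntegerRing C := fun n =>
    ⟨PreTilt.untilt (root n x) / PreTilt.untilt (root n y), IntegerRing.mem_iff.2 (by
      rw [norm_div]
      exact div_le_one_of_le₀ (hle n) (_root_.norm_nonneg _))⟩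
  have hz : ∀ n, z (n + 1) ^ p = z n := fun n => Subtype.ext (by
    change (_ / _) ^ p = _ / _
    rw [div_pow, ← SubmonoidClass.coe_pow, ← SubmonoidClass.coe_pow, ← map_pow, ← map_pow,
      root_succ_pow, root_succ_pow])
  have hyz : ∀ n, PreTilt.untilt (root n y) * z n = PreTilt.untilt (root n x) :=
    fun n => Subtype.ext (mul_div_cancel₀ _ (hy₀ n))
  let w : TiltRing p C := (⟨fun n => Ideal.Quotient.mk _ (z n), fun n => by
    rw [← map_pow, hz]⟩ : Perfection (ModP (IntegerRing C) p) p)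
  have hw : ∀ n, PreTilt.coeff n w = Ideal.Quotient.mk _ (z n) := fun n => rfl
  refine ⟨w, ext fun n => ?_⟩
  rw [map_mul, hw, coeff_eq, coeff_eq, ← hyz, map_mul]

theorem norm_lt_one_of_not_isUnit {x : TiltRing p C} (h : ¬ IsUnit x) : norm x < 1 := by
  by_contra! h'
  exact h (isUnit_of_dvd_one (dvd_of_norm_le (by rwa [norm_one])))

theorem exists_dvd_pow {s t : TiltRing p C} (hs : s ≠ 0) (ht : ¬ IsUnit t) : ∃ k, s ∣ t ^ k := by
  have h : 0 < norm s := lt_of_le_of_ne (norm_nonneg s) fun h => hs (norm_eq_zero.1 h.symm)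
  obtain ⟨k, hk⟩ := exists_pow_lt_of_lt_one h (norm_lt_one_of_not_isUnit ht)
  exact ⟨k, dvd_of_norm_le (by rw [norm_pow]; exact hk.le)⟩

end TiltRing

namespace Ainf

theorem p_dvd_iff {x : Ainf p C} : (p : Ainf p C) ∣ x ↔ x.coeff 0 = 0 := by
  rw [← Ideal.mem_span_singleton, WittVector.mem_span_p_iff_coeff_zero_eq_zero]

variable [CharZero C] [CompleteSpace C]

/-- The multiplicative norm on `𝒪♭` makes `p` prime and decides divisibility modulo `p`; Teichmüller
representatives lift the quotients. -/
theorem isValuativeAt : IsValuativeAt (p : Ainf p C) where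
  prime := by
    have h₁ : ¬ (p : Ainf p C) ∣ 1 := fun h => by
      rw [p_dvd_iff, WittVector.one_coeff_zero, ← TiltRing.norm_eq_zero, TiltRing.norm_one] at h
      exact one_ne_zero h
    refine ⟨fun h => ?_, fun h => h₁ (isUnit_iff_dvd_one.1 h), fun x y h => ?_⟩
    · have := WittVector.eq_zero_of_p_mul_eq_zero (1 : Ainf p C) (by rw [h, mul_zero])
      exact h₁ (this ▸ dvd_zero _)
    · rw [p_dvd_iff, WittVector.mul_coeff_zero, ← TiltRing.norm_eq_zero, TiltRing.norm_mul,
        mul_eq_zero, TiltRing.norm_eq_zero, TiltRing.norm_eq_zero] at h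
      rwa [p_dvd_iff, p_dvd_iff]
  mul_eq_zero x h := WittVector.eq_zero_of_p_mul_eq_zero x (by rwa [mul_comm])
  mem_jacobson := by
    have := IsAdicComplete.le_jacobson_bot (Ideal.span {(p : Ainf p C)})
    exact this (Ideal.mem_span_singleton_self _)
  separated x h := by
    refine (inferInstance : IsHausdorff (Ideal.span {(p : Ainf p C)}) (Ainf p C)).haus x fun n => ?_
    rw [SModEq.zero, smul_eq_mul, Ideal.mul_top, Ideal.span_singleton_pow,
      Ideal.mem_span_singleton]
    exact h n
  total x y := by
    have key : ∀ x y : Ainf p C, x.coeff 0 ∣ y.coeff 0 → ∃ c, (p : Ainf p C) ∣ c * x - y := by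
      rintro x y ⟨c, hc⟩
      refine ⟨WittVector.teichmuller p c, p_dvd_iff.2 ?_⟩
      rw [← WittVector.constantCoeff_apply, map_sub, map_mul]
      change (WittVector.teichmuller p c).coeff 0 * x.coeff 0 - y.coeff 0 = 0
      rw [WittVector.teichmuller_coeff_zero, hc, mul_comm, sub_self]
    rcases le_total (TiltRing.norm (y.coeff 0)) (TiltRing.norm (x.coeff 0)) with h | h
    · exact (key x y (TiltRing.dvd_of_norm_le h)).imp fun _ => Or.inl
    · exact (key y x (TiltRing.dvd_of_norm_le h)).imp fun _ => Or.inr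

/-- An ideal containing a power of `p` and an element not divisible by `p` contains a power of
every ideal `⟨p, t⟩` with `t` topologically nilpotent modulo `p`. -/
theorem exists_span_pow_le {I : Ideal (Ainf p C)} {n : ℕ} (hn : (p : Ainf p C) ^ n ∈ I)
    {s : Ainf p C} (hs : ¬ (p : Ainf p C) ∣ s) (hsI : s ∈ I) {t : Ainf p C}
    (ht : ¬ IsUnit (t.coeff 0)) : ∃ m : ℕ, Ideal.span {(p : Ainf p C), t} ^ m ≤ I := by
  rw [p_dvd_iff] at hs
  obtain ⟨k, c, hc⟩ := TiltRing.exists_dvd_pow hs ht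
  have hp : (p : Ainf p C) ∈ I.radical := ⟨n, hn⟩
  -- A power of `t` is a multiple of `s` modulo `p`, so `p` and `t` both lie in the radical of `I`;
  -- finite generation of `⟨p, t⟩` gives one exponent.
  have hdvd : (p : Ainf p C) ∣ t ^ k - s * WittVector.teichmuller p c := by
    rw [p_dvd_iff, ← WittVector.constantCoeff_apply, map_sub, map_mul, map_pow]
    change t.coeff 0 ^ k - s.coeff 0 * (WittVector.teichmuller p c).coeff 0 = 0
    rw [WittVector.teichmuller_coeff_zero, hc, sub_self]
  have htk : t ^ k ∈ I.radical := by
    rw [← sub_add_cancel (t ^ k) (s * WittVector.teichmuller p c)]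
    exact add_mem (Ideal.mem_of_dvd _ hdvd hp) (Ideal.le_radical (I.mul_mem_right _ hsI))
  have htr : t ∈ I.radical := Ideal.radical_isRadical I ⟨k, htk⟩
  refine Ideal.exists_pow_le_of_le_radical_of_fg ?_ (Submodule.fg_span (Set.toFinite _))
  rw [Ideal.span_le, Set.insert_subset_iff, Set.singleton_subset_iff]
  exact ⟨hp, htr⟩

end Ainf

end Tilt

/-! ### Functoriality of torsion, free hull and cokernel. -/

section Functors

variable {A : Type u} [CommRing A] {p : A} (hp : Prime p)

section Linear

variable {M N P : Type*} [AddCommGroup M] [Module A M] [AddCommGroup N] [Module A N]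
  [AddCommGroup P] [Module A P]

variable (p M) in
/-- The localisation map `M → M[1/p]`. -/
noncomputable abbrev toAway : M →ₗ[A] LocalizedModule (Submonoid.powers p) M :=
  LocalizedModule.mkLinearMap (Submonoid.powers p) M

variable (p) in
/-- The map `M[1/p] → N[1/p]` induced by a linear map. -/
noncomputable def awayMap (f : M →ₗ[A] N) :
    LocalizedModule (Submonoid.powers p) M →ₗ[A] LocalizedModule (Submonoid.powers p) N :=
  IsLocalizedModule.map (Submonoid.powers p) (toAway p M) (toAway p N) f

@[simp]
theorem awayMap_toAway (f : M →ₗ[A] N) (x : M) :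
    awayMap p f (toAway p M x) = toAway p N (f x) :=
  IsLocalizedModule.map_apply _ _ _ _ _

@[simp]
theorem awayMap_id : awayMap p (LinearMap.id : M →ₗ[A] M) = LinearMap.id :=
  IsLocalizedModule.map_id _ _

theorem awayMap_comp (g : N →ₗ[A] P) (f : M →ₗ[A] N) :
    awayMap p (g ∘ₗ f) = awayMap p g ∘ₗ awayMap p f := by
  refine IsLocalizedModule.ext (Submonoid.powers p) (toAway p M)
    (IsLocalizedModule.map_units (S := Submonoid.powers p) (toAway p P)) ?_
  ext x
  simp only [LinearMap.comp_apply, awayMap_toAway]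

variable (M) in
/-- The elements of `M[1/p]` with a multiple by a scalar not divisible by `p` in the image of
`M`. -/
noncomputable abbrev freeHull : Submodule A (LocalizedModule (Submonoid.powers p) M) :=
  (LinearMap.range (toAway p M)).saturationOutside hp

theorem awayMap_mem_freeHull (f : M →ₗ[A] N) {x : LocalizedModule (Submonoid.powers p) M}
    (hx : x ∈ freeHull hp M) : awayMap p f x ∈ freeHull hp N := by
  obtain ⟨s, hs, y, hy⟩ := hx
  exact ⟨s, hs, f y, by rw [← map_smul, ← hy, awayMap_toAway]⟩

/-- The map of free hulls induced by a linear map. -/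
noncomputable def freeHullMap (f : M →ₗ[A] N) : freeHull hp M →ₗ[A] freeHull hp N :=
  (awayMap p f).restrict fun _ => awayMap_mem_freeHull hp f

theorem freeHullMap_toSaturationOutside (f : M →ₗ[A] N) (x : M) :
    freeHullMap hp f ((toAway p M).toSaturationOutside hp x) =
      (toAway p N).toSaturationOutside hp (f x) :=
  Subtype.ext (awayMap_toAway f x)

variable (p) in
/-- The map of `p`-power torsion submodules induced by a linear map. -/
noncomputable def torsionMap (f : M →ₗ[A] N) :
    LinearMap.ker (toAway p M) →ₗ[A] LinearMap.ker (toAway p N) :=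
  f.restrict fun x hx => by
    rw [LinearMap.mem_ker] at hx ⊢
    rw [← awayMap_toAway, hx, map_zero]

variable (M) in
/-- The cokernel of the map from a module to its free hull. -/
noncomputable abbrev freeHullQuotient : Type _ :=
  freeHull hp M ⧸ LinearMap.range ((toAway p M).toSaturationOutside hp)

theorem freeHullMap_id : freeHullMap hp (LinearMap.id : M →ₗ[A] M) = LinearMap.id :=
  LinearMap.ext fun x => Subtype.ext (LinearMap.congr_fun awayMap_id x.1)

theorem freeHullMap_comp (g : N →ₗ[A] P) (f : M →ₗ[A] N) :
    freeHullMap hp (g ∘ₗ f) = freeHullMap hp g ∘ₗ freeHullMap hp f :=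
  LinearMap.ext fun x => Subtype.ext (LinearMap.congr_fun (awayMap_comp g f) x.1)

/-- The map on cokernels induced by a linear map. -/
noncomputable def freeHullQuotientMap (f : M →ₗ[A] N) :
    freeHullQuotient hp M →ₗ[A] freeHullQuotient hp N :=
  Submodule.mapQ _ _ (freeHullMap hp f) <| by
    rintro _ ⟨x, rfl⟩
    exact ⟨f x, (freeHullMap_toSaturationOutside hp f x).symm⟩

theorem freeHullQuotientMap_id :
    freeHullQuotientMap hp (LinearMap.id : M →ₗ[A] M) = LinearMap.id :=
  Submodule.linearMap_qext _ <| LinearMap.ext fun x =>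
    congrArg (Submodule.mkQ _) (LinearMap.congr_fun (freeHullMap_id hp) x)

theorem freeHullQuotientMap_comp (g : N →ₗ[A] P) (f : M →ₗ[A] N) :
    freeHullQuotientMap hp (g ∘ₗ f) = freeHullQuotientMap hp g ∘ₗ freeHullQuotientMap hp f :=
  Submodule.linearMap_qext _ <| LinearMap.ext fun x =>
    congrArg (Submodule.mkQ _) (LinearMap.congr_fun (freeHullMap_comp hp g f) x)

end Linear

variable (p) in
/-- The functor of `p`-power torsion. -/
noncomputable def torsionFunctor : ModuleCat.{max u v} A ⥤ ModuleCat.{max u v} A where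
  obj M := ModuleCat.of A (LinearMap.ker (toAway p M))
  map f := ModuleCat.ofHom (torsionMap p f.hom)
  map_id _ := rfl
  map_comp _ _ := rfl

/-- The functor of free hulls. -/
noncomputable def freeHullFunctor : ModuleCat.{max u v} A ⥤ ModuleCat.{max u v} A where
  obj M := ModuleCat.of A (freeHull hp M)
  map f := ModuleCat.ofHom (freeHullMap hp f.hom)
  map_id _ := ModuleCat.hom_ext (freeHullMap_id hp)
  map_comp f g := ModuleCat.hom_ext (freeHullMap_comp hp g.hom f.hom)

/-- The functor of cokernels of the maps to the free hulls. -/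
noncomputable def freeHullQuotientFunctor : ModuleCat.{max u v} A ⥤ ModuleCat.{max u v} A where
  obj M := ModuleCat.of A (freeHullQuotient hp M)
  map f := ModuleCat.ofHom (freeHullQuotientMap hp f.hom)
  map_id _ := ModuleCat.hom_ext (freeHullQuotientMap_id hp)
  map_comp f g := ModuleCat.hom_ext (freeHullQuotientMap_comp hp g.hom f.hom)

variable (p) in
/-- The inclusion of the torsion. -/
noncomputable def torsionInclusion : torsionFunctor.{u, v} p ⟶ 𝟭 (ModuleCat.{max u v} A) where
  app M := ModuleCat.ofHom (LinearMap.ker (toAway p M)).subtype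
  naturality _ _ _ := rfl

/-- The map to the free hull. -/
noncomputable def toFreeHull : 𝟭 (ModuleCat.{max u v} A) ⟶ freeHullFunctor.{u, v} hp where
  app M := ModuleCat.ofHom ((toAway p M).toSaturationOutside hp)
  naturality _ _ f := by
    ext x
    exact (freeHullMap_toSaturationOutside hp f.hom x).symm

/-- The projection of the free hull. -/
noncomputable def freeHullProjection :
    freeHullFunctor.{u, v} hp ⟶ freeHullQuotientFunctor.{u, v} hp where
  app _ := ModuleCat.ofHom (Submodule.mkQ _)
  naturality _ _ _ := rfl

end Functors

/-! ### The theorem for `𝔸_inf`. -/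

theorem mainTheorem9 (p : ℕ) [Fact p.Prime] (C : Type u) [NormedField C] [IsUltrametricDist C]
    [CompleteSpace C] [IsAlgClosed C] [CharZero C]
    [CharP (IsLocalRing.ResidueField (IntegerRing C)) p] :
    -- finitely presented modules that are finite free after inverting `p` are perfect
    (∀ (M : Type v) [AddCommGroup M] [Module (Ainf p C) M],
      Module.FinitePresentation (Ainf p C) M →
      Module.Finite (AinfInvP p C)
        (LocalizedModule (Submonoid.powers (p : Ainf p C)) M) →
      Module.Free (AinfInvP p C)
        (LocalizedModule (Submonoid.powers (p : Ainf p C)) M) →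
      IsPerfectModule (Ainf p C) M) ∧
    -- the functorial exact sequence `0 → M_tor → M → M_free → M̄ → 0`
    (∃ (Tor Fr Bar : (IsFinPresFreeAway.{u, max u v} (Ainf p C)
          (p : Ainf p C)).FullSubcategory ⥤ ModuleCat.{max u v} (Ainf p C))
        (i : Tor ⟶ (IsFinPresFreeAway.{u, max u v} (Ainf p C) (p : Ainf p C)).ι)
        (j : (IsFinPresFreeAway.{u, max u v} (Ainf p C) (p : Ainf p C)).ι ⟶ Fr)
        (q : Fr ⟶ Bar),
      ∀ M : (IsFinPresFreeAway.{u, max u v} (Ainf p C) (p : Ainf p C)).FullSubcategory,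
        (Function.Injective (i.app M).hom ∧
          Function.Exact (i.app M).hom (j.app M).hom ∧
          Function.Exact (j.app M).hom (q.app M).hom ∧
          Function.Surjective (q.app M).hom) ∧
        (IsPerfectModule (Ainf p C) (Tor.obj M) ∧
          ∃ n : ℕ, ∀ x : Tor.obj M, (p : Ainf p C) ^ n • x = 0) ∧
        (Module.Finite (Ainf p C) (Fr.obj M) ∧ Module.Free (Ainf p C) (Fr.obj M)) ∧
        (IsPerfectModule (Ainf p C) (Bar.obj M) ∧
          ∀ t : Ainf p C, t.coeff 0 ≠ 0 → ¬ IsUnit (t.coeff 0) →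
            ∃ n : ℕ, Ideal.span {(p : Ainf p C), t} ^ n ≤
              Module.annihilator (Ainf p C) (Bar.obj M))) ∧
    -- finite projective modules over `𝔸_inf[1/p]` are finite free
    (∀ (N : Type v) [AddCommGroup N] [Module (AinfInvP p C) N],
      Module.Finite (AinfInvP p C) N → Module.Projective (AinfInvP p C) N →
      Module.Finite (AinfInvP p C) N ∧ Module.Free (AinfInvP p C) N) := by
  have hp : IsValuativeAt (p : Ainf p C) := Ainf.isValuativeAt
  refine ⟨?_, ?_, ?_⟩
  · intro M _ _ _ _ _
    exact (hp.structure_of_free_away (AinfInvP p C)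
      (toAway (p : Ainf p C) M)).1.isPerfectModule
  -- The three functors and the maps between them exist on all modules; the hypotheses on `M` enter
  -- only through finiteness, freeness and annihilation.
  · let ι := (IsFinPresFreeAway.{u, max u v} (Ainf p C) (p : Ainf p C)).ι
    refine ⟨ι ⋙ torsionFunctor.{u, v} (p : Ainf p C), ι ⋙ freeHullFunctor.{u, v} hp.prime,
      ι ⋙ freeHullQuotientFunctor.{u, v} hp.prime,
      Functor.whiskerLeft ι (torsionInclusion.{u, v} (p : Ainf p C)),
      Functor.whiskerLeft ι (toFreeHull.{u, v} hp.prime),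
      Functor.whiskerLeft ι (freeHullProjection.{u, v} hp.prime), ?_⟩
    rintro ⟨M, _, _, _⟩
    obtain ⟨-, ⟨h₁, n, h₂⟩, h₃, h₄, ⟨m, h₅⟩, s, hs, h₆⟩ :=
      hp.structure_of_free_away (AinfInvP p C) (toAway (p : Ainf p C) M)
    refine ⟨⟨Submodule.subtype_injective _, fun x => ?_, LinearMap.exact_map_mkQ_range _,
      Submodule.mkQ_surjective _⟩, ⟨h₁.isPerfectModule, n, h₂⟩, h₃, h₄.isPerfectModule, ?_⟩
    · constructor
      · exact fun h => ⟨⟨x, congrArg Subtype.val h⟩, rfl⟩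
      · rintro ⟨⟨y, hy⟩, rfl⟩
        exact Subtype.ext hy
    · exact fun t _ ht => Ainf.exists_span_pow_le (Module.mem_annihilator.2 h₅) hs
        (Module.mem_annihilator.2 h₆) ht
  · intro N _ _ _ _
    exact ⟨inferInstance, hp.free_of_projective_away (AinfInvP p C) N⟩
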